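/- **Theorem 2.1.** Fix a dimension $m\ge 1$ and a number $k\ge 0$ of auxiliary functions. A *local formula of degree $n$* is a finite sum $$P=\sum e_{\vec\alpha,\vec\beta}(g_{ij})\,(\partial_x^{\alpha_1}g_{i_1j_1})\cdots(\partial_x^{\alpha_a}g_{i_aj_a})\,(\partial_x^{\beta_1}\phi_{\mu_1})\cdots(\partial_x^{\beta_b}\phi_{\mu_b})$$ with $|\alpha_s|>0$, $|\beta_s|\ge 0$ and $|\alpha_1|+\dots+|\alpha_a|+|\beta_1|+\dots+|\beta_b|=n$ in each term, the coefficients $e_{\vec\alpha,\vec\beta}$ being continuous functions of the positive definite matrix $(g_{ij})$. A *local interior invariant* $\mathcal E_n$, homogeneous of degree $n$ in the jets of the metric and of $\phi_1,\dots,\phi_k$, is given by a local formula of degree $n$ whose value does not depend on the choice of local coordinates. A *local boundary invariant* $\mathcal F_{n-1}$, homogeneous of degree $n-1$, is given by a local formula of degree $n-1$, evaluated at boundary points in coordinates with values in a half-space, whose value there does not depend on the choice of such coordinates. There exist constants $\kappa(\mathcal E_n)>0$ for all interior invariants $\mathcal E_n$ ($n\ge 0$) and $\kappa(\mathcal F_{n-1})>0$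 for all boundary invariants $\mathcal F_{n-1}$ ($n\ge 1$), depending only on the invariant, with the following property. Let $M$ be a non-empty compact real analytic manifold of dimension $m$ with (possibly empty) real analytic boundary. Then one can choose, for every real analytic Riemannian metric $g$ and all real analytic functions $\phi_1,\dots,\phi_k$ on $M$, a constant $C=C(M,g,\phi_1,\dots,\phi_k)>0$, independent of $n$, $\mathcal E_n$ and $\mathcal F_{n-1}$, so that for all $\mathcal E_n$ and all $\mathcal F_{n-1}$ $$\Bigl|\int_M \mathcal E_n(x,g,\phi_1,\dots)\,d\mathrm{vol}_m\Bigr|\le \kappa(\mathcal E_n)\,C^n\,\mathrm{vol}_m(M,g),$$ $$\Bigl|\int_{\partial M}\mathcal F_{n-1}(y,g,\phi_1,\dots)\,d\mathrm{vol}_{m-1}\Bigr|\le \kappa(\mathcal F_{n-1})\,C^{n-1}\,\mathrm{vol}_{m-1}(\partial M,g),$$ where an estimate for an invariant of degree $0$ (that is, $\mathcal E_0$ or $\mathcal F_0$) is asserted only if $|\phi_\mu|\le 1$ on $M$ for all $\mu$ (for instance, if $k=0$); and so that, for every $c>0$, $$C(M,c^2g,\phi_1,\dots,\phi_k)=c^{-1}\,C(M,g,\phi_1,\dots,\phi_k).$$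 -/

import Mathlib

open Set MeasureTheory Bundle
open scoped Manifold ContDiff

/-! ### Local formulas in the jets of a metric and of auxiliary functions -/

/-- The jet variables, in dimension `m`, of a metric and of `k` auxiliary functions.
`metric i j I` stands for the partial derivative of **positive** order
`∂_{I 0} ⋯ ∂_{I r} g_{ij}`, and `func μ I` stands for the partial derivative (possibly of order
zero) `∂_{I 0} ⋯ ∂_{I (r-1)} φ_μ`. A multi-index `α` is represented by any list of indices in
which each `i` occurs `α i` times. -/
inductive JetVar (m k : ℕ) : Type
  | metric (i j : Fin m) {r : ℕ} (I : Fin (r + 1) → Fin m) : JetVar m k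
  | func (μ : Fin k) {r : ℕ} (I : Fin r → Fin m) : JetVar m k

/-- The number of differentiations in a jet variable. -/
def JetVar.order {m k : ℕ} : JetVar m k → ℕ
  | @JetVar.metric _ _ _ _ r _ => r + 1
  | @JetVar.func _ _ _ r _ => r

/-- Local formulas: polynomials in the jet variables, the coefficients of which are functions of
the matrix `(g_{ij})`. -/
abbrev LocalFormula (m k : ℕ) : Type :=
  MvPolynomial (JetVar m k) (Matrix (Fin m) (Fin m) ℝ → ℝ)

/-- The partial derivative `∂_{I 0} ⋯ ∂_{I (r-1)} f (x)` of a function on `U`, where `U` is a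
relatively open subset of `ℝ^m` or of a half-space. -/
noncomputable def partialDeriv {m : ℕ} (U : Set (EuclideanSpace ℝ (Fin m)))
    (f : EuclideanSpace ℝ (Fin m) → ℝ) {r : ℕ} (I : Fin r → Fin m)
    (x : EuclideanSpace ℝ (Fin m)) : ℝ :=
  iteratedFDerivWithin ℝ r f U x (fun s => EuclideanSpace.single (I s) (1 : ℝ))

/-- The values at `x` of the jet variables, for a metric `G = (g_{ij})` and functions `φ_μ` given
on `U`. -/
noncomputable def JetVar.value {m k : ℕ} (U : Set (EuclideanSpace ℝ (Fin m)))
    (G : EuclideanSpace ℝ (Fin m) → Matrix (Fin m) (Fin m) ℝ)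
    (φ : Fin k → EuclideanSpace ℝ (Fin m) → ℝ) (x : EuclideanSpace ℝ (Fin m)) :
    JetVar m k → ℝ
  | JetVar.metric i j I => partialDeriv U (fun y => G y i j) I x
  | JetVar.func μ I => partialDeriv U (φ μ) I x

/-- The value at `x` of a local formula, for a metric `G = (g_{ij})` and functions `φ_μ` given on
`U`: the coefficients are evaluated at `(g_{ij}(x))` and the variables at the jets at `x`. -/
noncomputable def LocalFormula.value {m k : ℕ} (P : LocalFormula m k)
    (U : Set (EuclideanSpace ℝ (Fin m)))
    (G : EuclideanSpace ℝ (Fin m) → Matrix (Fin m) (Fin m) ℝ)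
    (φ : Fin k → EuclideanSpace ℝ (Fin m) → ℝ) (x : EuclideanSpace ℝ (Fin m)) : ℝ :=
  MvPolynomial.eval₂ (Pi.evalRingHom (fun _ : Matrix (Fin m) (Fin m) ℝ => ℝ) (G x))
    (JetVar.value U G φ x) P

/-! ### Invariance under changes of coordinates -/

/-- `U` is a relatively open subset of `H`. -/
def IsRelOpen {m : ℕ} (H U : Set (EuclideanSpace ℝ (Fin m))) : Prop :=
  ∃ O : Set (EuclideanSpace ℝ (Fin m)), IsOpen O ∧ U = O ∩ H

/-- `ψ : U → V` is a smooth diffeomorphism, with inverse `χ`, between relatively open subsets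
of `H`. -/
structure IsCoordChange {m : ℕ} (H U V : Set (EuclideanSpace ℝ (Fin m)))
    (ψ χ : EuclideanSpace ℝ (Fin m) → EuclideanSpace ℝ (Fin m)) : Prop where
  relOpen_source : IsRelOpen H U
  relOpen_target : IsRelOpen H V
  mapsTo : MapsTo ψ U V
  mapsTo_inv : MapsTo χ V U
  leftInv : LeftInvOn χ ψ U
  rightInv : RightInvOn χ ψ V
  contDiffOn : ContDiffOn ℝ ∞ ψ U
  contDiffOn_inv : ContDiffOn ℝ ∞ χ V

/-- `G` is a smooth Riemannian metric on `V`. -/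
structure IsLocalMetric {m : ℕ} (V : Set (EuclideanSpace ℝ (Fin m)))
    (G : EuclideanSpace ℝ (Fin m) → Matrix (Fin m) (Fin m) ℝ) : Prop where
  contDiffOn : ∀ i j, ContDiffOn ℝ ∞ (fun y => G y i j) V
  posDef : ∀ y ∈ V, (G y).PosDef

/-- The pulled back metric `(ψ^* G)_{ij} = ∑_{a, b} ∂_i ψ_a ∂_j ψ_b (G_{ab} ∘ ψ)` on `U`. -/
noncomputable def pullbackMetric {m : ℕ} (U : Set (EuclideanSpace ℝ (Fin m)))
    (ψ : EuclideanSpace ℝ (Fin m) → EuclideanSpace ℝ (Fin m))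
    (G : EuclideanSpace ℝ (Fin m) → Matrix (Fin m) (Fin m) ℝ)
    (x : EuclideanSpace ℝ (Fin m)) : Matrix (Fin m) (Fin m) ℝ :=
  Matrix.of fun i j => ∑ a, ∑ b,
    (fderivWithin ℝ ψ U x (EuclideanSpace.single i (1 : ℝ))) a *
      (fderivWithin ℝ ψ U x (EuclideanSpace.single j (1 : ℝ))) b * G (ψ x) a b

/-- The formula `P` is invariant, at the points of `Z`, under all changes of coordinates between
relatively open subsets of `H`. -/
def LocalFormula.IsInvariant {m k : ℕ} (P : LocalFormula m k)
    (H Z : Set (EuclideanSpace ℝ (Fin m))) : Prop :=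
  ∀ (U V : Set (EuclideanSpace ℝ (Fin m)))
    (ψ χ : EuclideanSpace ℝ (Fin m) → EuclideanSpace ℝ (Fin m)), IsCoordChange H U V ψ χ →
  ∀ (G : EuclideanSpace ℝ (Fin m) → Matrix (Fin m) (Fin m) ℝ), IsLocalMetric V G →
  ∀ (φ : Fin k → EuclideanSpace ℝ (Fin m) → ℝ), (∀ μ, ContDiffOn ℝ ∞ (φ μ) V) →
  ∀ x ∈ U ∩ Z,
    P.value U (pullbackMetric U ψ G) (fun μ => φ μ ∘ ψ) x = P.value V G φ (ψ x)

/-- Local interior invariants in dimension `m`, homogeneous of degree `n` in the jets of the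
metric and of `k` auxiliary functions: polynomials in the jets, with coefficients continuous in
`(g_{ij})`, in each monomial of which exactly `n` differentiations occur, and the value of which
does not depend on the coordinates. -/
structure InteriorInvariant (m k n : ℕ) : Type where
  formula : LocalFormula m k
  continuousOn_coeff : ∀ s, ContinuousOn (MvPolynomial.coeff s formula)
    {A : Matrix (Fin m) (Fin m) ℝ | A.PosDef}
  homogeneous : MvPolynomial.IsWeightedHomogeneous JetVar.order formula n
  invariant : formula.IsInvariant univ univ

/-- Local boundary invariants in dimension `m` (the boundary has dimension `m - 1`), homogeneous
of degree `p` in the jets, tangential and normal, of the metric and of `k` auxiliary functions: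
the formula is used at points of the boundary, in coordinates taking values in the half-space
`{x | 0 ≤ x 0}`, and its value there does not depend on the choice of such coordinates. -/
structure BoundaryInvariant (m k p : ℕ) [NeZero m] : Type where
  formula : LocalFormula m k
  continuousOn_coeff : ∀ s, ContinuousOn (MvPolynomial.coeff s formula)
    {A : Matrix (Fin m) (Fin m) ℝ | A.PosDef}
  homogeneous : MvPolynomial.IsWeightedHomogeneous JetVar.order formula p
  invariant : formula.IsInvariant {x | 0 ≤ x 0} {x | x 0 = 0}

/-! ### Real analytic Riemannian manifolds with boundary -/

section Manifold

variable {d : ℕ} {M : Type*} [TopologicalSpace M] [ChartedSpace (EuclideanHalfSpace (d + 1)) M]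

/-- Real analytic Riemannian metrics on a real analytic manifold, possibly with boundary, of
dimension `d + 1`. -/
abbrev AnalyticMetric (d : ℕ) (M : Type*) [TopologicalSpace M]
    [ChartedSpace (EuclideanHalfSpace (d + 1)) M] [IsManifold (𝓡∂ (d + 1)) ω M] : Type _ :=
  ContMDiffRiemannianMetric (𝓡∂ (d + 1)) ω (EuclideanSpace ℝ (Fin (d + 1)))
    (fun x : M => TangentSpace (𝓡∂ (d + 1)) x)

variable [IsManifold (𝓡∂ (d + 1)) ω M]

set_option synthInstance.maxHeartbeats 400000 in
/-- The metric `c² g`. -/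
noncomputable def AnalyticMetric.scale (g : AnalyticMetric d M) (c : ℝ) (hc : 0 < c) :
    AnalyticMetric d M where
  inner x := c ^ 2 • g.inner x
  symm x v w := by
    change c ^ 2 * g.inner x v w = c ^ 2 * g.inner x w v
    rw [g.symm]
  pos x v hv := mul_pos (pow_pos hc 2) (g.pos x v hv)
  isVonNBounded x := by
    refine ((g.isVonNBounded x).image
      (c⁻¹ • ContinuousLinearMap.id ℝ (TangentSpace (𝓡∂ (d + 1)) x))).subset ?_
    intro v hv
    refine ⟨c • v, ?_, ?_⟩
    · have h : c ^ 2 * g.inner x v v < 1 := hv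
      simpa [pow_two, mul_assoc] using h
    · simp [smul_smul, mul_inv_cancel₀ hc.ne']
  contMDiff := g.contMDiff.const_smul_section (a := c ^ 2)

/-- The matrix `(g_{ij})` of the metric in the preferred chart at `x`, as a function on the target
of this chart: `g_{ij} (y) = g (∂_i, ∂_j)` at the point with coordinates `y`. -/
noncomputable def chartMetric (g : AnalyticMetric d M) (x : M)
    (y : EuclideanSpace ℝ (Fin (d + 1))) : Matrix (Fin (d + 1)) (Fin (d + 1)) ℝ :=
  Matrix.of fun i j => g.inner ((extChartAt (𝓡∂ (d + 1)) x).symm y)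
    (mfderivWithin 𝓘(ℝ, EuclideanSpace ℝ (Fin (d + 1))) (𝓡∂ (d + 1))
      (extChartAt (𝓡∂ (d + 1)) x).symm (range (𝓡∂ (d + 1))) y
      (EuclideanSpace.single i (1 : ℝ) : EuclideanSpace ℝ (Fin (d + 1))))
    (mfderivWithin 𝓘(ℝ, EuclideanSpace ℝ (Fin (d + 1))) (𝓡∂ (d + 1))
      (extChartAt (𝓡∂ (d + 1)) x).symm (range (𝓡∂ (d + 1))) y
      (EuclideanSpace.single j (1 : ℝ) : EuclideanSpace ℝ (Fin (d + 1))))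

/-- The value at `x ∈ M` of a local formula. It is computed in the preferred chart at `x`; for an
invariant formula, any other chart gives the same result. -/
noncomputable def LocalFormula.valueAt {k : ℕ} (P : LocalFormula (d + 1) k)
    (g : AnalyticMetric d M) (φ : Fin k → M → ℝ) (x : M) : ℝ :=
  P.value (extChartAt (𝓡∂ (d + 1)) x).target (chartMetric g x)
    (fun μ => φ μ ∘ (extChartAt (𝓡∂ (d + 1)) x).symm) (extChartAt (𝓡∂ (d + 1)) x x)

variable [MeasurableSpace M]

/-- The measure `√(det (g_{ij})) dx` on the domain of the preferred chart at `x`. -/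
noncomputable def chartVolume (g : AnalyticMetric d M) (x : M) : Measure M :=
  Measure.map (extChartAt (𝓡∂ (d + 1)) x).symm
    ((volume.restrict (extChartAt (𝓡∂ (d + 1)) x).target).withDensity
      fun y => ENNReal.ofReal (Real.sqrt (chartMetric g x y).det))

/-- The Riemannian measure `dvol_m` of `(M, g)`, `m = d + 1`. The measures `√(det (g_{ij})) dx` of
any two charts agree on the intersection of their domains, so that the smallest measure which
dominates all of them is the measure which restricts to each of them. -/
noncomputable def riemannianVolume (g : AnalyticMetric d M) : Measure M :=
  ⨆ x : M, chartVolume g x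

/-- The inclusion of `ℝ^d` as the boundary hyperplane `{x | x 0 = 0}` of the half-space of
dimension `d + 1`. -/
noncomputable def boundaryIncl (d : ℕ) (z : EuclideanSpace ℝ (Fin d)) :
    EuclideanSpace ℝ (Fin (d + 1)) :=
  WithLp.toLp 2 (Fin.cons (0 : ℝ) (fun i => z i))

/-- The measure `√(det (g_{ij})_{i, j ≥ 1}) dx_1 ⋯ dx_d` of the restriction of `g` to the boundary,
on the part of the boundary which lies in the domain of the preferred chart at `x`, as a measure
on `M`. -/
noncomputable def chartBoundaryVolume (g : AnalyticMetric d M) (x : M) : Measure M :=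
  Measure.map ((extChartAt (𝓡∂ (d + 1)) x).symm ∘ boundaryIncl d)
    ((volume.restrict (boundaryIncl d ⁻¹' (extChartAt (𝓡∂ (d + 1)) x).target)).withDensity
      fun z => ENNReal.ofReal
        (Real.sqrt ((chartMetric g x (boundaryIncl d z)).submatrix Fin.succ Fin.succ).det))

/-- The Riemannian measure `dvol_{m-1}` of `(∂M, g|_{∂M})`, as a measure on `M` which is
concentrated on `∂M`. If `m = 1`, it counts the points of `∂M`. -/
noncomputable def riemannianBoundaryVolume (g : AnalyticMetric d M) : Measure M :=
  ⨆ x : M, chartBoundaryVolume g x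

end Manifold

open scoped Topology NNReal ENNReal

local notation "𝔼" n:max => EuclideanSpace ℝ (Fin n)

/-!
The integrands are bounded pointwise. By a linear change of half-space coordinates which preserves
the boundary hyperplane, the metric becomes the identity matrix at a given point, so that the
coefficients of an invariant enter only through their values at the identity. Real analyticity
gives Cauchy estimates `|∂^α u| ≤ A K ^ |α| |α|!` for the normalized jets, locally uniformly in the
point and hence uniformly on a compact manifold. In a monomial with `N` factors and of total degree
`n`, the powers of `K` multiply up to `K ^ n`, while `A ^ N ≤ N! e ^ A ≤ N! (e ^ A) ^ n` if `n > 0`,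
where `N!` only depends on the invariant. If `n = 0`, only undifferentiated factors `φ_μ` occur, and
`|φ_μ| ≤ 1` takes the place of the Cauchy estimates.

The bound is proved for `g` rescaled so that a fixed tangent vector has length one, and carried
back to `g`; this makes `C` homogeneous under `g ↦ c² g`. An interior invariant is independent of
the coordinates at boundary points as well, because the interior is dense.
-/

/-! ### Cauchy estimates -/

section Cauchy

variable {𝕜 E F : Type*} [NontriviallyNormedField 𝕜] [NormedAddCommGroup E] [NormedSpace 𝕜 E]
  [NormedAddCommGroup F] [NormedSpace 𝕜 F]

theorem exists_nnnorm_changeOrigin_le (p : FormalMultilinearSeries 𝕜 E F) {ρ : ℝ≥0} (hρ : 0 < ρ)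
    (hp : (ρ + ρ : ℝ≥0∞) < p.radius) :
    ∃ A : ℝ≥0, ∀ y : E, ‖y‖₊ ≤ ρ → ∀ n, ‖p.changeOrigin y n‖₊ ≤ A * ρ⁻¹ ^ n := by
  have hsum := NNReal.summable_sigma.1 (p.changeOriginSeries_summable_aux₁ hp)
  have hρp : (ρ : ℝ≥0∞) < p.radius := (le_add_right le_rfl).trans_lt hp
  refine ⟨∑' k : ℕ, ∑' s : Σ l : ℕ, { s : Finset (Fin (k + l)) // s.card = l },
    ‖p (k + s.1)‖₊ * ρ ^ s.1 * ρ ^ k, fun y hy n => ?_⟩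
  have hsum_n := p.changeOriginSeries_summable_aux₂ hρp n
  have hmono : ∀ s : Σ l : ℕ, { s : Finset (Fin (n + l)) // s.card = l },
      ‖p (n + s.1)‖₊ * ‖y‖₊ ^ s.1 ≤ ‖p (n + s.1)‖₊ * ρ ^ s.1 := fun s => by gcongr
  have hcoeff := (p.nnnorm_changeOrigin_le n ((ENNReal.coe_le_coe.2 hy).trans_lt hρp)).trans
    ((NNReal.summable_of_le hmono hsum_n).tsum_le_tsum hmono hsum_n)
  rw [inv_pow, ← div_eq_mul_inv, le_div_iff₀ (by positivity)]
  calc ‖p.changeOrigin y n‖₊ * ρ ^ n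
      ≤ (∑' s : Σ l : ℕ, { s : Finset (Fin (n + l)) // s.card = l },
          ‖p (n + s.1)‖₊ * ρ ^ s.1) * ρ ^ n := by gcongr
    _ = ∑' s : Σ l : ℕ, { s : Finset (Fin (n + l)) // s.card = l },
          ‖p (n + s.1)‖₊ * ρ ^ s.1 * ρ ^ n := (NNReal.tsum_mul_right _ _).symm
    _ ≤ _ := hsum.2.le_tsum' n

variable [CompleteSpace F] {f : E → F} {x : E}

theorem norm_iteratedFDeriv_le_factorial_mul_norm_coeff {p : FormalMultilinearSeries 𝕜 E F}
    {r : ℝ≥0∞} (hp : HasFPowerSeriesOnBall f p x r) (n : ℕ) :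
    ‖iteratedFDeriv 𝕜 n f x‖ ≤ n.factorial * ‖p n‖ := by
  refine ContinuousMultilinearMap.opNorm_le_bound (by positivity) fun v => ?_
  have hterm : ∀ σ ∈ (Finset.univ : Finset (Equiv.Perm (Fin n))),
      ‖p n (fun i => v (σ i))‖ ≤ ‖p n‖ * ∏ i, ‖v i‖ := fun σ _ => by
    simpa only [Equiv.prod_comp σ (fun i => ‖v i‖)] using (p n).le_opNorm fun i => v (σ i)
  rw [hp.iteratedFDeriv_eq_sum_of_completeSpace]
  calc ‖∑ σ : Equiv.Perm (Fin n), p n (fun i => v (σ i))‖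
      ≤ Fintype.card (Equiv.Perm (Fin n)) • (‖p n‖ * ∏ i, ‖v i‖) :=
        (norm_sum_le _ _).trans (Finset.sum_le_card_nsmul _ _ _ hterm)
    _ = n.factorial * ‖p n‖ * ∏ i, ‖v i‖ := by
        rw [Fintype.card_perm, Fintype.card_fin, nsmul_eq_mul, mul_assoc]

theorem exists_norm_iteratedFDeriv_le_of_analyticAt (hf : AnalyticAt 𝕜 f x) :
    ∃ K : ℝ, ∀ᶠ y in 𝓝 x, ∀ n, ‖iteratedFDeriv 𝕜 n f y‖ ≤ K * K ^ n * n.factorial := by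
  obtain ⟨p, r, hp⟩ := hf
  obtain ⟨ρ, hρ, hρr⟩ : ∃ ρ : ℝ≥0, 0 < ρ ∧ (ρ + ρ : ℝ≥0∞) < r := by
    obtain ⟨q, hq, hqr⟩ := ENNReal.lt_iff_exists_nnreal_btwn.1 hp.r_pos
    refine ⟨q / 2, by simpa using hq, ?_⟩
    rwa [← ENNReal.coe_add, add_halves]
  obtain ⟨A, hA⟩ := exists_nnnorm_changeOrigin_le p hρ (hρr.trans_le hp.r_le)
  refine ⟨max (A : ℝ) (ρ : ℝ)⁻¹, ?_⟩
  filter_upwards [Metric.ball_mem_nhds x (NNReal.coe_pos.2 hρ)] with y hy n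
  have hyρ : ‖y - x‖₊ ≤ ρ := (mem_ball_iff_norm.1 hy).le
  have hpy := hp.changeOrigin (y := y - x)
    ((ENNReal.coe_le_coe.2 hyρ).trans_lt ((le_add_right le_rfl).trans_lt hρr))
  rw [add_sub_cancel] at hpy
  calc ‖iteratedFDeriv 𝕜 n f y‖ ≤ n.factorial * ‖p.changeOrigin (y - x) n‖ :=
        norm_iteratedFDeriv_le_factorial_mul_norm_coeff hpy n
    _ ≤ n.factorial * (A * (ρ : ℝ)⁻¹ ^ n) := by gcongr; exact_mod_cast hA _ hyρ n
    _ ≤ n.factorial * (max (A : ℝ) (ρ : ℝ)⁻¹ * max (A : ℝ) (ρ : ℝ)⁻¹ ^ n) := by gcongr <;> simp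
    _ = _ := mul_comm _ _

theorem exists_norm_iteratedFDerivWithin_le_of_contDiffOn {s : Set E} (hf : ContDiffOn 𝕜 ω f s)
    (hs : UniqueDiffOn 𝕜 s) (hx : x ∈ s) :
    ∃ K : ℝ, ∀ᶠ y in 𝓝[s] x, ∀ n,
      ‖iteratedFDerivWithin 𝕜 n f s y‖ ≤ K * K ^ n * n.factorial := by
  obtain ⟨g, hfg, hg⟩ := analyticWithinAt_iff_exists_analyticAt.1
    (contDiffWithinAt_omega_iff_analyticWithinAt.1 (hf x hx))
  rw [insert_eq_of_mem hx] at hfg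
  obtain ⟨K, hK⟩ := exists_norm_iteratedFDeriv_le_of_analyticAt hg
  have hfg' : ∀ᶠ y in 𝓝[s] x, f =ᶠ[𝓝[s] y] g := eventually_eventually_nhdsWithin.2 hfg
  refine ⟨K, ?_⟩
  filter_upwards [hfg', hg.eventually_analyticAt.filter_mono inf_le_left,
    hK.filter_mono inf_le_left, self_mem_nhdsWithin] with y hfgy hgy hKy hys n
  rw [hfgy.iteratedFDerivWithin_eq (hfgy.eq_of_nhdsWithin hys),
    iteratedFDerivWithin_eq_iteratedFDeriv hs hgy.contDiffAt hys]
  exact hKy n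

end Cauchy

/-! ### Normalization of a metric at a point -/

section Normalization

open Matrix

theorem exists_dotProduct_mulVec_eq_inner {ι : Type*} [Fintype ι] {A : Matrix ι ι ℝ}
    (hA : A.PosDef) :
    ∃ T : EuclideanSpace ℝ ι ≃L[ℝ] EuclideanSpace ℝ ι,
      ∀ v w : EuclideanSpace ℝ ι, v.ofLp ⬝ᵥ A *ᵥ w.ofLp = inner ℝ (T v) (T w) := by
  classical
  obtain ⟨B, hB⟩ : ∃ B : Matrix ι ι ℝ, A = Bᵀ * B := by
    open scoped MatrixOrder in
    obtain ⟨B, hB⟩ := CStarAlgebra.nonneg_iff_eq_star_mul_self.mp hA.posSemidef.nonneg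
    exact ⟨B, by simpa [star_eq_conjTranspose] using hB⟩
  have key : ∀ v w : EuclideanSpace ℝ ι,
      v.ofLp ⬝ᵥ A *ᵥ w.ofLp = inner ℝ (toEuclideanLin B v) (toEuclideanLin B w) := fun v w => by
    rw [hB, ← mulVec_mulVec, dotProduct_mulVec, vecMul_transpose,
      EuclideanSpace.inner_eq_star_dotProduct, dotProduct_comm]
    simp [toEuclideanLin]
  have hinj : Function.Injective (toEuclideanLin B) := by
    rw [injective_iff_map_eq_zero]
    intro v hv
    by_contra hv0
    have hpos := hA.dotProduct_mulVec_pos (x := v.ofLp) (by simpa using hv0)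
    rw [star_trivial, key, hv, inner_zero_left] at hpos
    exact hpos.false
  exact ⟨(LinearEquiv.ofInjectiveEndo _ hinj).toContinuousLinearEquiv, key⟩

variable {d : ℕ} {A : Matrix (Fin (d + 1)) (Fin (d + 1)) ℝ} {L : 𝔼(d + 1) ≃L[ℝ] 𝔼(d + 1)}

/-- `L` is a linear change of coordinates of the half-space `{x | 0 ≤ x 0}` in which the constant
metric `A` becomes the Euclidean one. -/
structure IsNormalizing (A : Matrix (Fin (d + 1)) (Fin (d + 1)) ℝ)
    (L : 𝔼(d + 1) ≃L[ℝ] 𝔼(d + 1)) : Prop where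
  coord_zero : ∃ c : ℝ, 0 < c ∧ ∀ x, L x 0 = c * x 0
  dotProduct_mulVec : ∀ v w, (L v).ofLp ⬝ᵥ A *ᵥ (L w).ofLp = inner ℝ v w

-- An isometry for `A` may be composed with a reflection, and one reflection turns the normal
-- covector of the boundary into a positive multiple of the first coordinate.
theorem exists_isNormalizing (hA : A.PosDef) : ∃ L, IsNormalizing A L := by
  obtain ⟨T, hT⟩ := exists_dotProduct_mulVec_eq_inner hA
  set e : 𝔼(d + 1) := EuclideanSpace.single 0 1 with he
  set u := ContinuousLinearMap.adjoint (T.symm : 𝔼(d + 1) →L[ℝ] 𝔼(d + 1)) e with hu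
  have inner_u : ∀ x, inner ℝ u x = T.symm x 0 := fun x => by
    rw [hu, ContinuousLinearMap.adjoint_inner_left, he, EuclideanSpace.inner_single_left]
    simp
  have hu0 : u ≠ 0 := fun h => by
    have := inner_u (T e)
    simp [h, he] at this
  set O := (ℝ ∙ (u - ‖u‖ • e))ᗮ.reflection with hO
  have hOu : O u = ‖u‖ • e := Submodule.reflection_sub (by simp [norm_smul, he])
  refine ⟨O.toContinuousLinearEquiv.trans T.symm, ⟨‖u‖, norm_pos_iff.2 hu0, fun x => ?_⟩,
    fun v w => by simp [hT]⟩
  calc T.symm (O x) 0 = inner ℝ u (O x) := (inner_u _).symm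
    _ = inner ℝ (O u) x := by rw [← O.inner_map_map u (O x), hO, Submodule.reflection_reflection]
    _ = ‖u‖ * x 0 := by rw [hOu, inner_smul_left, he, EuclideanSpace.inner_single_left]; simp

theorem IsNormalizing.norm_single_sq_le (hL : IsNormalizing A L) (i : Fin (d + 1)) :
    ‖L (EuclideanSpace.single i 1)‖ ^ 2 ≤ A⁻¹.trace := by
  set J : Matrix (Fin (d + 1)) (Fin (d + 1)) ℝ :=
    Matrix.of fun a i => L (EuclideanSpace.single i 1) a with hJ
  have hJA : Jᵀ * A * J = 1 := by
    ext i j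
    rw [mul_mul_apply]
    exact (hL.dotProduct_mulVec _ _).trans (by simp [EuclideanSpace.inner_single_left, one_apply])
  have hinv : A⁻¹ = J * Jᵀ := inv_eq_left_inv <| by
    rw [mul_assoc, mul_eq_one_comm, hJA]
  calc ‖L (EuclideanSpace.single i 1)‖ ^ 2 = ∑ a, J a i ^ 2 := by
        simp [EuclideanSpace.norm_sq_eq, hJ]
    _ ≤ ∑ j, ∑ a, J a j ^ 2 := Finset.single_le_sum (f := fun j => ∑ a, J a j ^ 2)
        (fun j _ => Finset.sum_nonneg fun a _ => sq_nonneg _) (Finset.mem_univ i)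
    _ = A⁻¹.trace := by
        rw [hinv, Finset.sum_comm]
        simp only [trace, diag_apply, mul_apply, transpose_apply, pow_two]

theorem continuousOn_trace_inv {ι : Type*} [Fintype ι] [DecidableEq ι] :
    ContinuousOn (fun A : Matrix ι ι ℝ => A⁻¹.trace) {A | A.PosDef} := fun A hA => by
  have hdet : ContinuousAt Ring.inverse A.det := by
    rw [Ring.inverse_eq_inv']
    exact continuousAt_inv₀ hA.det_pos.ne'
  exact (Continuous.matrix_trace continuous_id).continuousAt.comp_continuousWithinAt
    (continuousAt_matrix_inv A hdet).continuousWithinAt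

end Normalization

/-! ### Relatively open subsets of the half-space -/

section HalfSpace

variable {d : ℕ} {U : Set (𝔼(d + 1))} {x : 𝔼(d + 1)}

theorem IsRelOpen.subset {m : ℕ} {H U : Set (𝔼 m)} (hU : IsRelOpen H U) : U ⊆ H := by
  obtain ⟨O, -, rfl⟩ := hU
  exact inter_subset_right

theorem IsRelOpen.eventuallyEq {m : ℕ} {H U : Set (𝔼 m)} {x : 𝔼 m} (hU : IsRelOpen H U)
    (hx : x ∈ U) : U =ᶠ[𝓝 x] H := by
  obtain ⟨O, hO, rfl⟩ := hU
  filter_upwards [hO.mem_nhds hx.1] with y hy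
  exact propext ⟨fun h => h.2, fun h => ⟨hy, h⟩⟩

/-- The closed half-space of dimension `d + 1`, in which the charts take their values. -/
def halfSpace (d : ℕ) : Set (𝔼(d + 1)) := {x | 0 ≤ x 0}

theorem range_model_eq_halfSpace : range (𝓡∂ (d + 1)) = halfSpace d :=
  range_modelWithCornersEuclideanHalfSpace (d + 1)

theorem uniqueDiffOn_halfSpace : UniqueDiffOn ℝ (halfSpace d) :=
  range_model_eq_halfSpace (d := d) ▸ (𝓡∂ (d + 1)).uniqueDiffOn

theorem isClosed_halfSpace : IsClosed (halfSpace d) :=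
  range_model_eq_halfSpace (d := d) ▸ (𝓡∂ (d + 1)).isClosed_range

theorem isOpen_pos_coord : IsOpen {x : 𝔼(d + 1) | 0 < x 0} :=
  isOpen_lt continuous_const (EuclideanSpace.proj (𝕜 := ℝ) (0 : Fin (d + 1))).continuous

theorem inter_pos_coord_eventuallyEq (U : Set (𝔼(d + 1))) (hx : 0 < x 0) :
    (U ∩ {x | 0 < x 0} : Set (𝔼(d + 1))) =ᶠ[𝓝 x] U := by
  filter_upwards [isOpen_pos_coord.mem_nhds hx] with y hy
  exact propext ⟨fun h => h.1, fun h => ⟨h, hy⟩⟩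

theorem IsRelOpen.uniqueDiffOn (hU : IsRelOpen (halfSpace d) U) : UniqueDiffOn ℝ U := by
  obtain ⟨O, hO, rfl⟩ := hU
  rw [inter_comm]
  exact uniqueDiffOn_halfSpace.inter hO

theorem IsRelOpen.measurableSet (hU : IsRelOpen (halfSpace d) U) : MeasurableSet U := by
  obtain ⟨O, hO, rfl⟩ := hU
  exact hO.measurableSet.inter isClosed_halfSpace.measurableSet

theorem IsRelOpen.mem_nhds (hU : IsRelOpen (halfSpace d) U) (hx : x ∈ U) (hx0 : 0 < x 0) :
    U ∈ 𝓝 x :=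
  (Filter.congr_sets (hU.eventuallyEq hx).mem_iff).2 <|
    Filter.mem_of_superset (isOpen_pos_coord.mem_nhds hx0) fun y (hy : 0 < y 0) => hy.le

theorem IsRelOpen.isOpen_inter_pos_coord (hU : IsRelOpen (halfSpace d) U) :
    IsOpen (U ∩ {x | 0 < x 0}) :=
  isOpen_iff_mem_nhds.2 fun _ hx =>
    Filter.inter_mem (hU.mem_nhds hx.1 hx.2) (isOpen_pos_coord.mem_nhds hx.2)

theorem IsRelOpen.mem_closure_inter_pos_coord (hU : IsRelOpen (halfSpace d) U) (hx : x ∈ U) :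
    x ∈ closure (U ∩ {x | 0 < x 0}) := by
  have hx0 : 0 ≤ x 0 := hU.subset hx
  have htendsto : Filter.Tendsto (fun t : ℝ => x + t • EuclideanSpace.single 0 1) (𝓝[>] 0) (𝓝 x) :=
    ((by fun_prop : Continuous fun t : ℝ => x + t • EuclideanSpace.single 0 1).tendsto' 0 x
      (by simp)).mono_left nhdsWithin_le_nhds
  refine mem_closure_of_tendsto htendsto ?_
  filter_upwards [htendsto.eventually (hU.eventuallyEq hx), self_mem_nhdsWithin] with t htU ht
  have hpos : 0 < (x + t • EuclideanSpace.single 0 1 : 𝔼(d + 1)) 0 := by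
    simpa using add_pos_of_nonneg_of_pos hx0 ht
  exact ⟨htU.mpr (le_of_lt hpos), hpos⟩

end HalfSpace

/-! ### Values of local formulas -/

section Value

variable {m k : ℕ} {U V : Set (𝔼 m)} {G G' : 𝔼 m → Matrix (Fin m) (Fin m) ℝ}
  {φ φ' : Fin k → 𝔼 m → ℝ} {x : 𝔼 m}

theorem partialDeriv_congr {f g : 𝔼 m → ℝ} (h : EqOn f g U) (hx : x ∈ U) {r : ℕ}
    (I : Fin r → Fin m) : partialDeriv U f I x = partialDeriv U g I x := by
  rw [partialDeriv, partialDeriv, iteratedFDerivWithin_congr h hx]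

theorem partialDeriv_congr_set {f : 𝔼 m → ℝ} (h : U =ᶠ[𝓝 x] V) {r : ℕ} (I : Fin r → Fin m) :
    partialDeriv U f I x = partialDeriv V f I x := by
  rw [partialDeriv, partialDeriv, iteratedFDerivWithin_congr_set h]

theorem JetVar.value_congr (hG : EqOn G G' U) (hφ : ∀ μ, EqOn (φ μ) (φ' μ) U) (hx : x ∈ U)
    (v : JetVar m k) : JetVar.value U G φ x v = JetVar.value U G' φ' x v := by
  cases v with
  | metric i j I => exact partialDeriv_congr (fun y hy => by simp only [hG hy]) hx I
  | func μ I => exact partialDeriv_congr (hφ μ) hx I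

theorem JetVar.value_congr_set (h : U =ᶠ[𝓝 x] V) (v : JetVar m k) :
    JetVar.value U G φ x v = JetVar.value V G φ x v := by
  cases v with
  | metric i j I => exact partialDeriv_congr_set h I
  | func μ I => exact partialDeriv_congr_set h I

theorem LocalFormula.value_congr (P : LocalFormula m k) (hG : EqOn G G' U)
    (hφ : ∀ μ, EqOn (φ μ) (φ' μ) U) (hx : x ∈ U) : P.value U G φ x = P.value U G' φ' x := by
  rw [LocalFormula.value, LocalFormula.value, hG hx, funext (JetVar.value_congr hG hφ hx)]

theorem LocalFormula.value_congr_set (P : LocalFormula m k) (h : U =ᶠ[𝓝 x] V) :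
    P.value U G φ x = P.value V G φ x := by
  rw [LocalFormula.value, LocalFormula.value, funext (JetVar.value_congr_set h)]

theorem LocalFormula.value_eq_sum (P : LocalFormula m k) :
    P.value U G φ x = ∑ s ∈ P.support,
      MvPolynomial.coeff s P (G x) * ∏ v ∈ s.support, JetVar.value U G φ x v ^ s v :=
  MvPolynomial.eval₂_eq _ _ _

theorem continuousOn_partialDeriv {f : 𝔼 m → ℝ} (hf : ContDiffOn ℝ ∞ f U)
    (hU : UniqueDiffOn ℝ U) {r : ℕ} (I : Fin r → Fin m) : ContinuousOn (partialDeriv U f I) U :=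
  (ContinuousMultilinearMap.apply ℝ (fun _ : Fin r => 𝔼 m) ℝ
    (fun s => EuclideanSpace.single (I s) (1 : ℝ))).continuous.comp_continuousOn
    (hf.continuousOn_iteratedFDerivWithin (m := r) (mod_cast le_top) hU)

theorem JetVar.continuousOn_value (hG : IsLocalMetric U G) (hφ : ∀ μ, ContDiffOn ℝ ∞ (φ μ) U)
    (hU : UniqueDiffOn ℝ U) (v : JetVar m k) :
    ContinuousOn (fun x => JetVar.value U G φ x v) U := by
  cases v with
  | metric i j I => exact continuousOn_partialDeriv (hG.contDiffOn i j) hU I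
  | func μ I => exact continuousOn_partialDeriv (hφ μ) hU I

theorem IsLocalMetric.continuousOn (hG : IsLocalMetric U G) : ContinuousOn G U :=
  continuousOn_pi.2 fun i => continuousOn_pi.2 fun j => (hG.contDiffOn i j).continuousOn

theorem IsLocalMetric.mono (hG : IsLocalMetric V G) (h : U ⊆ V) : IsLocalMetric U G where
  contDiffOn i j := (hG.contDiffOn i j).mono h
  posDef y hy := hG.posDef y (h hy)

theorem LocalFormula.continuousOn_value (P : LocalFormula m k)
    (hP : ∀ s, ContinuousOn (MvPolynomial.coeff s P) {A | A.PosDef}) (hG : IsLocalMetric U G)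
    (hφ : ∀ μ, ContDiffOn ℝ ∞ (φ μ) U) (hU : UniqueDiffOn ℝ U) :
    ContinuousOn (P.value U G φ) U := by
  rw [show P.value U G φ = _ from funext fun x => P.value_eq_sum]
  refine continuousOn_finsetSum _ fun s _ => ContinuousOn.mul ?_ ?_
  · exact (hP s).comp hG.continuousOn hG.posDef
  · exact continuousOn_finsetProd _ fun v _ => (JetVar.continuousOn_value hG hφ hU v).pow _

end Value

/-! ### Changes of coordinates -/

section CoordChange

open Matrix

variable {m : ℕ} {H U V : Set (𝔼 m)} {ψ χ : 𝔼 m → 𝔼 m} {G : 𝔼 m → Matrix (Fin m) (Fin m) ℝ}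
  {x : 𝔼 m}

/-- The Jacobian matrix `(∂_i ψ_a)_{a, i}` of `ψ` on `U`. -/
noncomputable def jacobian (U : Set (𝔼 m)) (ψ : 𝔼 m → 𝔼 m) (x : 𝔼 m) :
    Matrix (Fin m) (Fin m) ℝ :=
  LinearMap.toMatrix (EuclideanSpace.basisFun (Fin m) ℝ).toBasis
    (EuclideanSpace.basisFun (Fin m) ℝ).toBasis (fderivWithin ℝ ψ U x).toLinearMap

theorem jacobian_apply (a i : Fin m) :
    jacobian U ψ x a i = fderivWithin ℝ ψ U x (EuclideanSpace.single i 1) a := by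
  simp [jacobian, LinearMap.toMatrix_apply]

theorem jacobian_mulVec (v : 𝔼 m) :
    jacobian U ψ x *ᵥ v.ofLp = (fderivWithin ℝ ψ U x v).ofLp :=
  LinearMap.toMatrix_mulVec_repr _ _ _ v

theorem det_jacobian (x : 𝔼 m) : (jacobian U ψ x).det = (fderivWithin ℝ ψ U x).det := by
  rw [jacobian, LinearMap.det_toMatrix, ContinuousLinearMap.det]

theorem pullbackMetric_eq (x : 𝔼 m) :
    pullbackMetric U ψ G x = (jacobian U ψ x)ᵀ * G (ψ x) * jacobian U ψ x := by
  ext i j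
  simp only [pullbackMetric, of_apply, mul_apply, transpose_apply, jacobian_apply, Finset.sum_mul]
  rw [Finset.sum_comm]
  exact Finset.sum_congr rfl fun a _ => Finset.sum_congr rfl fun b _ => by ring

theorem pullbackMetric_apply (x : 𝔼 m) (i j : Fin m) :
    pullbackMetric U ψ G x i j = (fderivWithin ℝ ψ U x (EuclideanSpace.single i 1)).ofLp ⬝ᵥ
      G (ψ x) *ᵥ (fderivWithin ℝ ψ U x (EuclideanSpace.single j 1)).ofLp := by
  rw [pullbackMetric_eq, mul_mul_apply]
  congr 2

theorem pullbackMetric_congr_set (h : U =ᶠ[𝓝 x] V) :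
    pullbackMetric U ψ G x = pullbackMetric V ψ G x := by
  simp only [pullbackMetric, fderivWithin_congr_set h]

theorem IsCoordChange.symm (h : IsCoordChange H U V ψ χ) : IsCoordChange H V U χ ψ where
  relOpen_source := h.relOpen_target
  relOpen_target := h.relOpen_source
  mapsTo := h.mapsTo_inv
  mapsTo_inv := h.mapsTo
  leftInv := h.rightInv
  rightInv := h.leftInv
  contDiffOn := h.contDiffOn_inv
  contDiffOn_inv := h.contDiffOn

theorem IsCoordChange.hasFDerivWithinAt (h : IsCoordChange H U V ψ χ) (hx : x ∈ U) :
    HasFDerivWithinAt ψ (fderivWithin ℝ ψ U x) U x :=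
  (h.contDiffOn.differentiableOn (by simp) x hx).hasFDerivWithinAt

theorem IsCoordChange.injective_fderivWithin (h : IsCoordChange H U V ψ χ)
    (hU : UniqueDiffOn ℝ U) (hx : x ∈ U) : Function.Injective (fderivWithin ℝ ψ U x) := by
  have hcomp : HasFDerivWithinAt id
      ((fderivWithin ℝ χ V (ψ x)).comp (fderivWithin ℝ ψ U x)) U x :=
    ((h.symm.hasFDerivWithinAt (h.mapsTo hx)).comp x (h.hasFDerivWithinAt hx) h.mapsTo).congr
      (fun y hy => (h.leftInv hy).symm) (h.leftInv hx).symm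
  have hid := (hU x hx).eq hcomp (hasFDerivWithinAt_id x U)
  exact Function.LeftInverse.injective (g := fderivWithin ℝ χ V (ψ x)) fun v =>
    DFunLike.congr_fun hid v

theorem IsCoordChange.isLocalMetric_pullback (h : IsCoordChange H U V ψ χ)
    (hU : UniqueDiffOn ℝ U) (hG : IsLocalMetric V G) :
    IsLocalMetric U (pullbackMetric U ψ G) where
  contDiffOn i j := by
    have hD : ∀ i a, ContDiffOn ℝ ∞
        (fun x => fderivWithin ℝ ψ U x (EuclideanSpace.single i 1) a) U := fun i a =>
      contDiffOn_euclidean.1 ((h.contDiffOn.fderivWithin hU (by simp)).clm_apply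
        contDiffOn_const) a
    simp only [pullbackMetric, Matrix.of_apply]
    exact ContDiffOn.sum fun a _ => ContDiffOn.sum fun b _ =>
      ((hD i a).mul (hD j b)).mul ((hG.contDiffOn a b).comp h.contDiffOn h.mapsTo)
  posDef y hy := by
    rw [pullbackMetric_eq, ← conjTranspose_eq_transpose_of_trivial]
    refine (hG.posDef _ (h.mapsTo hy)).conjTranspose_mul_mul_same fun v w hvw => ?_
    have hD := (jacobian_mulVec (WithLp.toLp 2 v)).symm.trans
      (hvw.trans (jacobian_mulVec (WithLp.toLp 2 w)))
    exact WithLp.toLp_injective 2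
      (h.injective_fderivWithin hU hy (WithLp.ofLp_injective 2 hD))

variable {L : 𝔼 m ≃L[ℝ] 𝔼 m}

theorem partialDeriv_comp_linear (L : 𝔼 m ≃L[ℝ] 𝔼 m) (hU : UniqueDiffOn ℝ U) (f : 𝔼 m → ℝ)
    (hx : L x ∈ U) {r : ℕ} (I : Fin r → Fin m) :
    partialDeriv (L ⁻¹' U) (f ∘ L) I x =
      iteratedFDerivWithin ℝ r f U (L x) fun s => L (EuclideanSpace.single (I s) 1) := by
  rw [partialDeriv, L.iteratedFDerivWithin_comp_right f hU hx]
  rfl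

theorem partialDeriv_comp_smul {c : ℝ} (hL : ∀ x, L x = c • x) (hU : UniqueDiffOn ℝ U)
    (f : 𝔼 m → ℝ) (hx : L x ∈ U) {r : ℕ} (I : Fin r → Fin m) :
    partialDeriv (L ⁻¹' U) (f ∘ L) I x = c ^ r * partialDeriv U f I (L x) := by
  rw [partialDeriv_comp_linear L hU f hx]
  simp only [hL]
  rw [ContinuousMultilinearMap.map_smul_univ]
  simp [partialDeriv]

theorem pullbackMetric_linear_apply (hU : UniqueDiffOn ℝ U) (hx : L x ∈ U) (i j : Fin m) :
    pullbackMetric (L ⁻¹' U) L G x i j =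
      (L (EuclideanSpace.single i 1)).ofLp ⬝ᵥ G (L x) *ᵥ (L (EuclideanSpace.single j 1)).ofLp := by
  have hD : fderivWithin ℝ L (L ⁻¹' U) x = L :=
    L.hasFDerivWithinAt.fderivWithin (L.uniqueDiffOn_preimage_iff.2 hU x hx)
  rw [pullbackMetric_apply, hD]
  rfl

theorem pullbackMetric_smul {c : ℝ} (hL : ∀ x, L x = c • x) (hU : UniqueDiffOn ℝ U)
    (hx : L x ∈ U) : pullbackMetric (L ⁻¹' U) L G x = c ^ 2 • G (L x) := by
  ext i j
  rw [pullbackMetric_linear_apply hU hx, hL (EuclideanSpace.single i 1),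
    hL (EuclideanSpace.single j 1)]
  simp [mulVec_smul, pow_two, mul_assoc]

end CoordChange

/-! ### Invariants of the half-space -/

section Invariance

variable {d k n : ℕ} {U V Z : Set (𝔼(d + 1))} {ψ χ : 𝔼(d + 1) → 𝔼(d + 1)}
  {G : 𝔼(d + 1) → Matrix (Fin (d + 1)) (Fin (d + 1)) ℝ} {φ : Fin k → 𝔼(d + 1) → ℝ}
  {x y : 𝔼(d + 1)} {P : LocalFormula (d + 1) k}

-- Otherwise the first coordinate of `ψ` has a local minimum at `x`, and `fderiv ψ x` is not onto.
theorem IsCoordChange.pos_of_pos (h : IsCoordChange (halfSpace d) U V ψ χ) (hx : x ∈ U)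
    (hx0 : 0 < x 0) : 0 < ψ x 0 := by
  have nonneg : ∀ y ∈ U, 0 ≤ ψ y 0 := fun y hy => h.relOpen_target.subset (h.mapsTo hy)
  refine lt_of_le_of_ne (nonneg x hx) fun hψ0 => ?_
  have hU := h.relOpen_source.mem_nhds hx hx0
  have hmin : IsLocalMin (fun y => ψ y 0) x := by
    filter_upwards [hU] with y hy
    exact hψ0 ▸ nonneg y hy
  have hderiv := hmin.hasFDerivAt_eq_zero
    ((EuclideanSpace.proj (𝕜 := ℝ) (0 : Fin (d + 1))).hasFDerivAt.comp x
      ((h.hasFDerivWithinAt hx).hasFDerivAt hU))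
  obtain ⟨v, hv⟩ := (LinearMap.injective_iff_surjective
    (f := (fderivWithin ℝ ψ U x).toLinearMap)).1
    (h.injective_fderivWithin h.relOpen_source.uniqueDiffOn hx) (EuclideanSpace.single 0 1)
  have hv0 : (fderivWithin ℝ ψ U x v) 0 = 0 := DFunLike.congr_fun hderiv v
  simp [show fderivWithin ℝ ψ U x v = EuclideanSpace.single 0 1 from hv] at hv0

theorem IsCoordChange.coord_eq_zero_iff (h : IsCoordChange (halfSpace d) U V ψ χ) (hx : x ∈ U) :
    ψ x 0 = 0 ↔ x 0 = 0 := by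
  have hx0 : 0 ≤ x 0 := h.relOpen_source.subset hx
  have hψ0 : 0 ≤ ψ x 0 := h.relOpen_target.subset (h.mapsTo hx)
  have hpos : 0 < ψ x 0 ↔ 0 < x 0 := by
    refine ⟨fun hpos => ?_, h.pos_of_pos hx⟩
    simpa only [h.leftInv hx] using h.symm.pos_of_pos (h.mapsTo hx) hpos
  rw [← hψ0.not_lt_iff_eq', ← hx0.not_lt_iff_eq', hpos]

theorem IsCoordChange.restrict_pos_coord (h : IsCoordChange (halfSpace d) U V ψ χ) :
    IsCoordChange univ (U ∩ {x | 0 < x 0}) (V ∩ {x | 0 < x 0}) ψ χ where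
  relOpen_source := ⟨_, h.relOpen_source.isOpen_inter_pos_coord, (inter_univ _).symm⟩
  relOpen_target := ⟨_, h.relOpen_target.isOpen_inter_pos_coord, (inter_univ _).symm⟩
  mapsTo _ hy := ⟨h.mapsTo hy.1, h.pos_of_pos hy.1 hy.2⟩
  mapsTo_inv _ hy := ⟨h.mapsTo_inv hy.1, h.symm.pos_of_pos hy.1 hy.2⟩
  leftInv := h.leftInv.mono inter_subset_left
  rightInv := h.rightInv.mono inter_subset_left
  contDiffOn := h.contDiffOn.mono inter_subset_left
  contDiffOn_inv := h.contDiffOn_inv.mono inter_subset_left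

theorem isCoordChange_linear {L : 𝔼(d + 1) ≃L[ℝ] 𝔼(d + 1)} {c : ℝ} (hc : 0 < c)
    (hL : ∀ x, L x 0 = c * x 0) (hV : IsRelOpen (halfSpace d) V) :
    IsCoordChange (halfSpace d) (L ⁻¹' V) V L L.symm where
  relOpen_source := by
    obtain ⟨O, hO, rfl⟩ := hV
    refine ⟨L ⁻¹' O, hO.preimage L.continuous, ?_⟩
    rw [preimage_inter]
    congr 1
    ext x
    change 0 ≤ L x 0 ↔ 0 ≤ x 0
    rw [hL, mul_nonneg_iff_of_pos_left hc]
  relOpen_target := hV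
  mapsTo _ hx := hx
  mapsTo_inv x hx := by rwa [mem_preimage, L.apply_symm_apply]
  leftInv x _ := L.symm_apply_apply x
  rightInv x _ := L.apply_symm_apply x
  contDiffOn := L.contDiff.contDiffOn
  contDiffOn_inv := L.symm.contDiff.contDiffOn

theorem LocalFormula.IsInvariant.value_pullbackMetric_of_pos (hP : P.IsInvariant univ univ)
    (h : IsCoordChange (halfSpace d) U V ψ χ) (hG : IsLocalMetric V G)
    (hφ : ∀ μ, ContDiffOn ℝ ∞ (φ μ) V) (hx : x ∈ U) (hx0 : 0 < x 0) :
    P.value U (pullbackMetric U ψ G) (fun μ => φ μ ∘ ψ) x = P.value V G φ (ψ x) := by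
  have hinv := hP _ _ ψ χ h.restrict_pos_coord G (hG.mono inter_subset_left) φ
    (fun μ => (hφ μ).mono inter_subset_left) x ⟨⟨hx, hx0⟩, mem_univ x⟩
  rw [P.value_congr_set (inter_pos_coord_eventuallyEq V (h.pos_of_pos hx hx0))] at hinv
  rw [← hinv, ← P.value_congr_set (inter_pos_coord_eventuallyEq U hx0)]
  exact P.value_congr
    (fun y hy => (pullbackMetric_congr_set (inter_pos_coord_eventuallyEq U hy.2)).symm)
    (fun μ y _ => rfl) ⟨hx, hx0⟩

theorem LocalFormula.IsInvariant.halfSpace (hP : P.IsInvariant univ univ)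
    (hc : ∀ s, ContinuousOn (MvPolynomial.coeff s P) {A | A.PosDef}) :
    P.IsInvariant (halfSpace d) univ := by
  intro U V ψ χ h G hG φ hφ x hx
  have hU := h.relOpen_source.uniqueDiffOn
  have hleft := P.continuousOn_value hc (h.isLocalMetric_pullback hU hG)
    (fun μ => (hφ μ).comp h.contDiffOn h.mapsTo) hU x hx.1
  have hright := (P.continuousOn_value hc hG hφ h.relOpen_target.uniqueDiffOn).comp
    h.contDiffOn.continuousOn h.mapsTo x hx.1
  -- Both sides are continuous on `U`, and they agree on its dense interior part.
  have := mem_closure_iff_nhdsWithin_neBot.1 (h.relOpen_source.mem_closure_inter_pos_coord hx.1)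
  refine tendsto_nhds_unique (l := 𝓝[U ∩ {x | 0 < x 0}] x)
    (hleft.mono inter_subset_left).tendsto
    ((hright.mono inter_subset_left).tendsto.congr' ?_)
  filter_upwards [self_mem_nhdsWithin] with y hy
  exact (hP.value_pullbackMetric_of_pos h hG hφ hy.1 hy.2).symm

/-- The sets at the points of which invariants are considered: the whole space for interior
invariants and the boundary hyperplane for boundary invariants. -/
def IsStratum (Z : Set (𝔼(d + 1))) : Prop :=
  Z = univ ∨ Z = {x | x 0 = 0}

theorem IsStratum.mem_iff (hZ : IsStratum Z) (h : x 0 = 0 ↔ y 0 = 0) : x ∈ Z ↔ y ∈ Z := by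
  rcases hZ with rfl | rfl
  · simp
  · exact h

/-- `P` is homogeneous of degree `n` and invariant, at the points of the stratum `Z`, under changes
of half-space coordinates. This is the common framework for interior and boundary invariants. -/
structure LocalFormula.IsStratumInvariant (P : LocalFormula (d + 1) k) (Z : Set (𝔼(d + 1)))
    (n : ℕ) : Prop where
  isStratum : IsStratum Z
  continuousOn_coeff : ∀ s, ContinuousOn (MvPolynomial.coeff s P) {A | A.PosDef}
  homogeneous : MvPolynomial.IsWeightedHomogeneous JetVar.order P n
  isInvariant : P.IsInvariant (halfSpace d) Z

theorem InteriorInvariant.isStratumInvariant (E : InteriorInvariant (d + 1) k n) :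
    E.formula.IsStratumInvariant univ n where
  isStratum := Or.inl rfl
  continuousOn_coeff := E.continuousOn_coeff
  homogeneous := E.homogeneous
  isInvariant := E.invariant.halfSpace E.continuousOn_coeff

theorem BoundaryInvariant.isStratumInvariant (F : BoundaryInvariant (d + 1) k n) :
    F.formula.IsStratumInvariant {x | x 0 = 0} n where
  isStratum := Or.inr rfl
  continuousOn_coeff := F.continuousOn_coeff
  homogeneous := F.homogeneous
  isInvariant := F.invariant

theorem LocalFormula.IsStratumInvariant.value_linear (hP : P.IsStratumInvariant Z n)
    (hV : IsRelOpen (halfSpace d) V) (hG : IsLocalMetric V G) (hφ : ∀ μ, ContDiffOn ℝ ∞ (φ μ) V)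
    {L : 𝔼(d + 1) ≃L[ℝ] 𝔼(d + 1)} {c : ℝ} (hc : 0 < c) (hL : ∀ x, L x 0 = c * x 0)
    (hx : L x ∈ V) (hxZ : L x ∈ Z) :
    P.value (L ⁻¹' V) (pullbackMetric (L ⁻¹' V) L G) (fun μ => φ μ ∘ L) x =
      P.value V G φ (L x) :=
  hP.isInvariant _ _ L L.symm (isCoordChange_linear hc hL hV) G hG φ hφ x
    ⟨hx, (hP.isStratum.mem_iff (by rw [hL, mul_eq_zero_iff_left hc.ne'])).1 hxZ⟩

theorem prod_pow_pow_eq_pow_weight {σ : Type*} (w : σ → ℕ) (s : σ →₀ ℕ) (c : ℝ) :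
    ∏ v ∈ s.support, (c ^ w v) ^ s v = c ^ Finsupp.weight w s := by
  rw [Finsupp.weight_apply, Finsupp.sum, ← Finset.prod_pow_eq_pow_sum]
  exact Finset.prod_congr rfl fun v _ => by rw [smul_eq_mul, ← pow_mul, mul_comm]

theorem JetVar.value_comp_smul {L : 𝔼(d + 1) ≃L[ℝ] 𝔼(d + 1)} {c : ℝ} (hL : ∀ x, L x = c • x)
    (hV : UniqueDiffOn ℝ V) (hx : L x ∈ V) (v : JetVar (d + 1) k) :
    JetVar.value (L ⁻¹' V) (pullbackMetric (L ⁻¹' V) L G) (fun μ => φ μ ∘ L) x v =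
      c ^ v.order * JetVar.value V (fun z => c ^ 2 • G z) φ (L x) v := by
  cases v with
  | metric i j I =>
    refine (partialDeriv_congr (fun z hz => ?_) (mem_preimage.2 hx) I).trans
      (partialDeriv_comp_smul hL hV (fun z => (c ^ 2 • G z) i j) hx I)
    rw [pullbackMetric_smul hL hV hz, Function.comp_apply]
  | func μ I => exact partialDeriv_comp_smul hL hV (φ μ) hx I

theorem LocalFormula.value_comp_smul {L : 𝔼(d + 1) ≃L[ℝ] 𝔼(d + 1)} {c : ℝ}
    (hn : MvPolynomial.IsWeightedHomogeneous JetVar.order P n) (hL : ∀ x, L x = c • x)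
    (hV : UniqueDiffOn ℝ V) (hx : L x ∈ V) :
    P.value (L ⁻¹' V) (pullbackMetric (L ⁻¹' V) L G) (fun μ => φ μ ∘ L) x =
      c ^ n * P.value V (fun z => c ^ 2 • G z) φ (L x) := by
  rw [LocalFormula.value_eq_sum, LocalFormula.value_eq_sum, Finset.mul_sum]
  refine Finset.sum_congr rfl fun s hs => ?_
  simp only [JetVar.value_comp_smul hL hV hx, mul_pow, Finset.prod_mul_distrib,
    pullbackMetric_smul hL hV hx, prod_pow_pow_eq_pow_weight,
    hn (MvPolynomial.mem_support_iff.1 hs)]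
  ring

theorem LocalFormula.IsStratumInvariant.value_smul_metric (hP : P.IsStratumInvariant Z n)
    (hV : IsRelOpen (halfSpace d) V) (hG : IsLocalMetric V G) (hφ : ∀ μ, ContDiffOn ℝ ∞ (φ μ) V)
    (hy : y ∈ V) (hyZ : y ∈ Z) {c : ℝ} (hc : 0 < c) :
    P.value V (fun z => c ^ 2 • G z) φ y = c⁻¹ ^ n * P.value V G φ y := by
  let L : 𝔼(d + 1) ≃L[ℝ] 𝔼(d + 1) :=
    (LinearEquiv.smulOfNeZero ℝ _ c hc.ne').toContinuousLinearEquiv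
  have hL : ∀ x, L x = c • x := fun x => rfl
  obtain ⟨x, rfl⟩ : ∃ x, L x = y := L.surjective y
  have hinv := hP.value_linear hV hG hφ hc (fun x => by simp [hL]) hy hyZ
  rw [LocalFormula.value_comp_smul hP.homogeneous hL hV.uniqueDiffOn hy] at hinv
  rw [← hinv, inv_pow, inv_mul_cancel_left₀ (pow_ne_zero _ hc.ne')]

end Invariance

/-! ### Estimates for the values of invariants -/

section Monomial

variable {σ : Type*} {w : σ → ℕ} {s : σ →₀ ℕ} {u : σ → ℝ}

theorem abs_prod_pow_le_one_of_weight_eq_zero (hs : Finsupp.weight w s = 0)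
    (hu : ∀ v, w v = 0 → |u v| ≤ 1) : |∏ v ∈ s.support, u v ^ s v| ≤ 1 := by
  rw [Finset.abs_prod]
  refine Finset.prod_le_one (fun _ _ => abs_nonneg _) fun v hv => ?_
  have hwv : w v = 0 := by
    have hsv := Finset.sum_eq_zero_iff.1 ((Finsupp.weight_apply w s).symm.trans hs) v hv
    exact (mul_eq_zero.1 hsv).resolve_left (Finsupp.mem_support_iff.1 hv)
  rw [abs_pow]
  exact pow_le_one₀ (abs_nonneg _) (hu v hwv)

theorem pow_le_factorial_mul_exp_pow {A : ℝ} (hA : 0 ≤ A) (N : ℕ) {n : ℕ} (hn : n ≠ 0) :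
    A ^ N ≤ N.factorial * Real.exp A ^ n := by
  calc A ^ N ≤ N.factorial * Real.exp A :=
        (div_le_iff₀' (by positivity)).1 (Real.pow_div_factorial_le_exp A hA N)
    _ ≤ N.factorial * Real.exp A ^ n := by
        gcongr
        exact le_self_pow₀ (Real.one_le_exp hA) hn

theorem abs_prod_pow_le_of_weight_ne_zero {A K : ℝ} (hA : 0 ≤ A) (hK : 0 ≤ K)
    (hs : Finsupp.weight w s ≠ 0) (hu : ∀ v, |u v| ≤ A * K ^ w v * (w v).factorial) :
    |∏ v ∈ s.support, u v ^ s v| ≤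
      s.degree.factorial * (∏ v ∈ s.support, ((w v).factorial : ℝ) ^ s v) *
        (Real.exp A * K) ^ Finsupp.weight w s := by
  calc |∏ v ∈ s.support, u v ^ s v|
      ≤ ∏ v ∈ s.support, (A * K ^ w v * (w v).factorial) ^ s v := by
        rw [Finset.abs_prod]
        refine Finset.prod_le_prod (fun _ _ => abs_nonneg _) fun v _ => ?_
        rw [abs_pow]
        exact pow_le_pow_left₀ (abs_nonneg _) (hu v) _
    _ = A ^ s.degree * K ^ Finsupp.weight w s *
          ∏ v ∈ s.support, ((w v).factorial : ℝ) ^ s v := by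
        simp only [mul_pow, Finset.prod_mul_distrib, prod_pow_pow_eq_pow_weight,
          Finset.prod_pow_eq_pow_sum, Finsupp.degree_apply]
    _ ≤ s.degree.factorial * Real.exp A ^ Finsupp.weight w s * K ^ Finsupp.weight w s *
          ∏ v ∈ s.support, ((w v).factorial : ℝ) ^ s v := by
        gcongr
        exact pow_le_factorial_mul_exp_pow hA _ hs
    _ = _ := by rw [mul_pow]; ring

end Monomial

section Estimates

variable {d k n : ℕ} {V Z : Set (𝔼(d + 1))} {x y : 𝔼(d + 1)} {B K : ℝ}
  {G : 𝔼(d + 1) → Matrix (Fin (d + 1)) (Fin (d + 1)) ℝ} {φ : Fin k → 𝔼(d + 1) → ℝ}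
  {L : 𝔼(d + 1) ≃L[ℝ] 𝔼(d + 1)} {P : LocalFormula (d + 1) k}

open Classical in
/-- The constant `κ(P)` in the estimates for an invariant `P`. Only the coefficients at `g = 1`
matter, since coordinates in which the metric is the identity at a given point are used. The
factorials absorb those in the Cauchy estimates for the jets, and the `1 +` makes it positive. -/
noncomputable def LocalFormula.kappa {m k : ℕ} (P : LocalFormula m k) : ℝ :=
  1 + ∑ s ∈ P.support, |MvPolynomial.coeff s P 1| *
    (s.degree.factorial * ∏ v ∈ s.support, (v.order.factorial : ℝ) ^ s v)

theorem LocalFormula.kappa_pos {m k : ℕ} (P : LocalFormula m k) : 0 < P.kappa :=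
  add_pos_of_pos_of_nonneg one_pos (Finset.sum_nonneg fun s _ => by positivity)

theorem LocalFormula.abs_value_le_of_metric_eq_one
    (hn : MvPolynomial.IsWeightedHomogeneous JetVar.order P n) (hG : G x = 1) {A : ℝ}
    (hA : 0 ≤ A) (hK : 0 ≤ K)
    (hu : ∀ v, |JetVar.value V G φ x v| ≤ A * K ^ v.order * v.order.factorial)
    (h0 : n ≠ 0 ∨ ∀ v, v.order = 0 → |JetVar.value V G φ x v| ≤ 1) :
    |P.value V G φ x| ≤ P.kappa * (Real.exp A * K) ^ n := by
  have monomial_le : ∀ s ∈ P.support, |∏ v ∈ s.support, JetVar.value V G φ x v ^ s v| ≤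
      s.degree.factorial * (∏ v ∈ s.support, (v.order.factorial : ℝ) ^ s v) *
        (Real.exp A * K) ^ n := by
    intro s hs
    obtain rfl := hn (MvPolynomial.mem_support_iff.1 hs)
    by_cases hs0 : Finsupp.weight JetVar.order s = 0
    · refine (abs_prod_pow_le_one_of_weight_eq_zero hs0
        (h0.resolve_left (not_not_intro hs0))).trans ?_
      rw [hs0, pow_zero, mul_one]
      have hprod : 0 < ∏ v ∈ s.support, v.order.factorial ^ s v :=
        Finset.prod_pos fun v _ => pow_pos v.order.factorial_pos _
      exact_mod_cast Nat.mul_pos s.degree.factorial_pos hprod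
    · exact abs_prod_pow_le_of_weight_ne_zero hA hK hs0 hu
  rw [LocalFormula.value_eq_sum, LocalFormula.kappa, hG, add_mul, Finset.sum_mul]
  refine (Finset.abs_sum_le_sum_abs _ _).trans
    (le_add_of_nonneg_of_le (by positivity) (Finset.sum_le_sum fun s hs => ?_))
  rw [abs_mul, mul_assoc]
  exact mul_le_mul_of_nonneg_left (monomial_le s hs) (abs_nonneg _)

theorem norm_iteratedFDerivWithin_sum_mul_le {E ι : Type*} [NormedAddCommGroup E]
    [NormedSpace ℝ E] (u : Finset ι) {c : ι → ℝ} {f : ι → E → ℝ} {s : Set E}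
    (hs : UniqueDiffOn ℝ s) {x : E} (hx : x ∈ s) {r : ℕ} (hf : ∀ i, ContDiffOn ℝ r (f i) s)
    {b M : ℝ} (hb : 0 ≤ b) (hc : ∀ i, |c i| ≤ b)
    (hM : ∀ i, ‖iteratedFDerivWithin ℝ r (f i) s x‖ ≤ M) :
    ‖iteratedFDerivWithin ℝ r (fun y => ∑ i ∈ u, c i * f i y) s x‖ ≤ u.card * (b * M) := by
  have hsum : iteratedFDerivWithin ℝ r (fun y => ∑ i ∈ u, c i * f i y) s x =
      ∑ i ∈ u, c i • iteratedFDerivWithin ℝ r (f i) s x := by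
    refine (iteratedFDerivWithin_fun_sum_apply (f := fun i => c i • f i) hs hx
      fun i _ => ((hf i).const_smul (c i)) x hx).trans (Finset.sum_congr rfl fun i _ => ?_)
    exact iteratedFDerivWithin_const_smul_apply (hf i x hx) hs hx
  rw [hsum, ← nsmul_eq_mul]
  refine (norm_sum_le _ _).trans (Finset.sum_le_card_nsmul _ _ _ fun i _ => ?_)
  rw [norm_smul]
  exact mul_le_mul (hc i) (hM i) (norm_nonneg _) hb

theorem abs_partialDeriv_comp_linear_le (hL : ∀ i, ‖L (EuclideanSpace.single i 1)‖ ≤ B)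
    (hV : UniqueDiffOn ℝ V) (hx : L x ∈ V) {r : ℕ} {f : 𝔼(d + 1) → ℝ} (I : Fin r → Fin (d + 1))
    {S : ℝ} (hS : ‖iteratedFDerivWithin ℝ r f V (L x)‖ ≤ S) :
    |partialDeriv (L ⁻¹' V) (f ∘ L) I x| ≤ S * B ^ r := by
  rw [partialDeriv_comp_linear L hV f hx, ← Real.norm_eq_abs]
  refine (ContinuousMultilinearMap.le_opNorm _ _).trans ?_
  refine mul_le_mul hS ?_ (by positivity) ((norm_nonneg _).trans hS)
  exact (Finset.prod_le_prod (fun _ _ => norm_nonneg _) fun s _ => hL (I s)).trans (by simp)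

/-- Cauchy estimates at `x`, with the constant `K`, for the derivatives on `V` of the functions
`g_{ij}` and `φ_μ`. -/
structure HasCauchyBounds (V : Set (𝔼(d + 1)))
    (G : 𝔼(d + 1) → Matrix (Fin (d + 1)) (Fin (d + 1)) ℝ) (φ : Fin k → 𝔼(d + 1) → ℝ)
    (K : ℝ) (x : 𝔼(d + 1)) : Prop where
  metric : ∀ i j r, ‖iteratedFDerivWithin ℝ r (fun z => G z i j) V x‖ ≤ K * K ^ r * r.factorial
  func : ∀ μ r, ‖iteratedFDerivWithin ℝ r (φ μ) V x‖ ≤ K * K ^ r * r.factorial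

theorem HasCauchyBounds.abs_partialDeriv_pullbackMetric_le (h : HasCauchyBounds V G φ K (L x))
    (hL : ∀ i, ‖L (EuclideanSpace.single i 1)‖ ≤ B) (hV : UniqueDiffOn ℝ V)
    (hG : IsLocalMetric V G) (hx : L x ∈ V) (i j : Fin (d + 1)) {r : ℕ}
    (I : Fin r → Fin (d + 1)) :
    |partialDeriv (L ⁻¹' V) (fun z => pullbackMetric (L ⁻¹' V) L G z i j) I x| ≤
      (d + 1) ^ 2 * B ^ 2 * K * (K * B) ^ r * r.factorial := by
  obtain ⟨c, hc⟩ : ∃ c : Fin (d + 1) × Fin (d + 1) → ℝ, ∀ p,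
      c p = L (EuclideanSpace.single i 1) p.1 * L (EuclideanSpace.single j 1) p.2 :=
    ⟨_, fun _ => rfl⟩
  have hpull : EqOn (fun z => pullbackMetric (L ⁻¹' V) L G z i j)
      ((fun z => ∑ p, c p * G z p.1 p.2) ∘ L) (L ⁻¹' V) := by
    intro z hz
    simp only [pullbackMetric_linear_apply hV hz, dotProduct, Matrix.mulVec, Finset.mul_sum, hc,
      Function.comp_apply, Fintype.sum_prod_type]
    exact Finset.sum_congr rfl fun a _ => Finset.sum_congr rfl fun b _ => by ring
  have hcoord : ∀ i a, |L (EuclideanSpace.single i 1) a| ≤ B := fun i a =>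
    (PiLp.norm_apply_le (L (EuclideanSpace.single i 1)) a).trans (hL i)
  have hcB : ∀ p, |c p| ≤ B ^ 2 := fun p => by
    rw [hc, abs_mul, pow_two]
    exact mul_le_mul (hcoord _ _) (hcoord _ _) (abs_nonneg _) ((abs_nonneg _).trans (hcoord i p.1))
  have hGr : ∀ p : Fin (d + 1) × Fin (d + 1), ContDiffOn ℝ r (fun z => G z p.1 p.2) V :=
    fun p => (hG.contDiffOn p.1 p.2).of_le (by exact_mod_cast le_top)
  have hderiv := norm_iteratedFDerivWithin_sum_mul_le Finset.univ hV hx hGr (sq_nonneg B) hcB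
    (fun p => h.metric p.1 p.2 r)
  rw [partialDeriv_congr hpull (mem_preimage.2 hx)]
  refine (abs_partialDeriv_comp_linear_le hL hV hx I hderiv).trans (le_of_eq ?_)
  rw [Finset.card_univ, Fintype.card_prod, Fintype.card_fin, mul_pow, Nat.cast_mul,
    Nat.cast_add_one]
  ring

theorem HasCauchyBounds.abs_value_comp_linear_le (h : HasCauchyBounds V G φ K (L x))
    (hL : ∀ i, ‖L (EuclideanSpace.single i 1)‖ ≤ B) (hV : UniqueDiffOn ℝ V)
    (hG : IsLocalMetric V G) (hx : L x ∈ V) (hB : 1 ≤ B) (hK : 0 ≤ K) (v : JetVar (d + 1) k) :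
    |JetVar.value (L ⁻¹' V) (pullbackMetric (L ⁻¹' V) L G) (fun μ => φ μ ∘ L) x v| ≤
      (d + 1) ^ 2 * B ^ 2 * K * (K * B) ^ v.order * v.order.factorial := by
  cases v with
  | metric i j I => exact h.abs_partialDeriv_pullbackMetric_le hL hV hG hx i j I
  | @func μ r I =>
    have hone : (1 : ℝ) ≤ (d + 1) ^ 2 * B ^ 2 :=
      one_le_mul_of_one_le_of_one_le (one_le_pow₀ (by linarith [d.cast_nonneg (α := ℝ)]))
        (one_le_pow₀ hB)
    calc |partialDeriv (L ⁻¹' V) (φ μ ∘ L) I x|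
        ≤ K * K ^ r * r.factorial * B ^ r :=
          abs_partialDeriv_comp_linear_le hL hV hx I (h.func μ r)
      _ = 1 * (K * (K * B) ^ r * r.factorial) := by rw [mul_pow]; ring
      _ ≤ ((d + 1) ^ 2 * B ^ 2) * (K * (K * B) ^ r * r.factorial) := by gcongr
      _ = _ := by rw [JetVar.order]; ring

theorem LocalFormula.IsStratumInvariant.abs_value_le (hP : P.IsStratumInvariant Z n)
    (hV : IsRelOpen (halfSpace d) V) (hG : IsLocalMetric V G) (hφ : ∀ μ, ContDiffOn ℝ ∞ (φ μ) V)
    (hy : y ∈ V) (hyZ : y ∈ Z) (hB : 1 ≤ B) (hK : 0 ≤ K) (htrace : (G y)⁻¹.trace ≤ B)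
    (h : HasCauchyBounds V G φ K y) (h0 : n ≠ 0 ∨ ∀ μ, |φ μ y| ≤ 1) :
    |P.value V G φ y| ≤ P.kappa * (Real.exp ((d + 1) ^ 2 * B ^ 2 * K) * (K * B)) ^ n := by
  obtain ⟨L, hL⟩ := exists_isNormalizing (hG.posDef y hy)
  obtain ⟨c, hc, hLc⟩ := hL.coord_zero
  obtain ⟨x, rfl⟩ : ∃ x, L x = y := L.surjective y
  have norm_le : ∀ i, ‖L (EuclideanSpace.single i 1)‖ ≤ B := fun i =>
    le_of_sq_le_sq (((hL.norm_single_sq_le i).trans htrace).trans (le_self_pow₀ hB two_ne_zero))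
      (by positivity)
  have metric_eq_one : pullbackMetric (L ⁻¹' V) L G x = 1 := by
    ext i j
    rw [pullbackMetric_linear_apply hV.uniqueDiffOn hy, hL.dotProduct_mulVec,
      EuclideanSpace.inner_single_left]
    simp [Matrix.one_apply]
  rw [← hP.value_linear hV hG hφ hc hLc hy hyZ]
  refine LocalFormula.abs_value_le_of_metric_eq_one hP.homogeneous metric_eq_one
    (by positivity) (by positivity)
    (h.abs_value_comp_linear_le norm_le hV.uniqueDiffOn hG hy hB hK) ?_
  refine h0.imp_right fun h0 v hv => ?_
  cases v with
  | metric i j I => exact absurd hv (Nat.succ_ne_zero _)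
  | func μ I =>
    obtain rfl : _ = 0 := hv
    simpa [JetVar.value, partialDeriv] using h0 μ

theorem exists_eventually_norm_iteratedFDerivWithin_le {E ι : Type*} [NormedAddCommGroup E]
    [NormedSpace ℝ E] [Finite ι] {f : ι → E → ℝ} {s : Set E} (hf : ∀ i, ContDiffOn ℝ ω (f i) s)
    (hs : UniqueDiffOn ℝ s) {x : E} (hx : x ∈ s) :
    ∃ K : ℝ, 0 < K ∧ ∀ᶠ y in 𝓝[s] x, ∀ i r,
      ‖iteratedFDerivWithin ℝ r (f i) s y‖ ≤ K * K ^ r * r.factorial := by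
  choose K hK using fun i => exists_norm_iteratedFDerivWithin_le_of_contDiffOn (hf i) hs hx
  obtain ⟨K', hK'⟩ := (finite_range fun i => |K i|).bddAbove
  refine ⟨max K' 1, by positivity, ?_⟩
  filter_upwards [Filter.eventually_all.2 hK] with y hy i r
  have hKi : |K i| ≤ max K' 1 := (hK' (mem_range_self i)).trans (le_max_left _ _)
  calc ‖iteratedFDerivWithin ℝ r (f i) s y‖ ≤ K i * K i ^ r * r.factorial := hy i r
    _ ≤ |K i| * |K i| ^ r * r.factorial := by
        rw [← abs_pow, ← abs_mul]
        gcongr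
        exact le_abs_self _
    _ ≤ _ := by gcongr

theorem exists_eventually_abs_value_le (hV : IsRelOpen (halfSpace d) V)
    (hG : ∀ i j, ContDiffOn ℝ ω (fun y => G y i j) V) (hpos : ∀ y ∈ V, (G y).PosDef)
    (hφ : ∀ μ, ContDiffOn ℝ ω (φ μ) V) (hx : x ∈ V) :
    ∃ C : ℝ, 0 < C ∧ ∀ᶠ y in 𝓝[V] x, ∀ (Z : Set (𝔼(d + 1))) (n : ℕ)
      (P : LocalFormula (d + 1) k), P.IsStratumInvariant Z n → y ∈ Z →
      (n ≠ 0 ∨ ∀ μ, |φ μ y| ≤ 1) → |P.value V G φ y| ≤ P.kappa * C ^ n := by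
  have hGm : IsLocalMetric V G := ⟨fun i j => (hG i j).of_le le_top, hpos⟩
  obtain ⟨K, hK, hderiv⟩ := exists_eventually_norm_iteratedFDerivWithin_le
    (f := Sum.elim (fun (q : Fin (d + 1) × Fin (d + 1)) z => G z q.1 q.2) φ)
    (by rintro (q | μ); exacts [hG q.1 q.2, hφ μ]) hV.uniqueDiffOn hx
  have htrace : ∀ᶠ y in 𝓝[V] x, (G y)⁻¹.trace < max ((G x)⁻¹.trace + 1) 1 :=
    (continuousOn_trace_inv.comp hGm.continuousOn hpos x hx).eventually_lt_const
      (lt_max_of_lt_left (lt_add_one _))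
  set B := max ((G x)⁻¹.trace + 1) 1
  have hB : 1 ≤ B := le_max_right _ _
  refine ⟨Real.exp ((d + 1) ^ 2 * B ^ 2 * K) * (K * B), by positivity, ?_⟩
  filter_upwards [hderiv, htrace, self_mem_nhdsWithin] with y hyK hyB hyV Z n P hP hyZ h0
  exact hP.abs_value_le hV hGm (fun μ => (hφ μ).of_le le_top) hyV hyZ hB hK.le
    hyB.le ⟨fun i j => hyK (Sum.inl (i, j)), fun μ => hyK (Sum.inr μ)⟩ h0

end Estimates

/-! ### Charts -/

section Charts

variable {d : ℕ} {M : Type*} [TopologicalSpace M] [ChartedSpace (EuclideanHalfSpace (d + 1)) M]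
  {p q x : M} {y : 𝔼(d + 1)}

local notation "𝓒" => extChartAt (𝓡∂ (d + 1))

theorem isRelOpen_extChartAt_preimage (p : M) {O : Set M} (hO : IsOpen O) :
    IsRelOpen (halfSpace d) ((𝓒 p).target ∩ (𝓒 p).symm ⁻¹' O) := by
  obtain ⟨u, hu, hu'⟩ := continuousOn_iff'.1 (continuousOn_extChartAt_symm (I := 𝓡∂ (d + 1)) p) O hO
  refine ⟨u ∩ (𝓡∂ (d + 1)).symm ⁻¹' (chartAt (EuclideanHalfSpace (d + 1)) p).target,
    hu.inter ((chartAt _ p).open_target.preimage (𝓡∂ (d + 1)).continuous_symm), ?_⟩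
  rw [inter_comm, hu', extChartAt_target, range_model_eq_halfSpace, inter_assoc]

theorem isRelOpen_extChartAt_target (p : M) : IsRelOpen (halfSpace d) (𝓒 p).target := by
  simpa using isRelOpen_extChartAt_preimage p isOpen_univ

/-- The domain of the change of coordinates between the preferred charts at `p` and `q`. -/
def overlap (d : ℕ) {M : Type*} [TopologicalSpace M] [ChartedSpace (EuclideanHalfSpace (d + 1)) M]
    (p q : M) : Set (𝔼(d + 1)) :=
  (extChartAt (𝓡∂ (d + 1)) p).target ∩
    (extChartAt (𝓡∂ (d + 1)) p).symm ⁻¹' (extChartAt (𝓡∂ (d + 1)) q).source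

/-- The change of coordinates between the preferred charts at `p` and `q`. -/
noncomputable def transition (d : ℕ) {M : Type*} [TopologicalSpace M]
    [ChartedSpace (EuclideanHalfSpace (d + 1)) M] (p q : M) : 𝔼(d + 1) → 𝔼(d + 1) :=
  extChartAt (𝓡∂ (d + 1)) q ∘ (extChartAt (𝓡∂ (d + 1)) p).symm

theorem isRelOpen_overlap (p q : M) : IsRelOpen (halfSpace d) (overlap d p q) :=
  isRelOpen_extChartAt_preimage p (isOpen_extChartAt_source q)

theorem overlap_eventuallyEq (hy : y ∈ overlap d p q) : overlap d p q =ᶠ[𝓝 y] (𝓒 p).target :=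
  ((isRelOpen_overlap p q).eventuallyEq hy).trans
    ((isRelOpen_extChartAt_target p).eventuallyEq hy.1).symm

theorem extChartAt_mem_overlap (hp : x ∈ (𝓒 p).source) (hq : x ∈ (𝓒 q).source) :
    𝓒 p x ∈ overlap d p q :=
  ⟨(𝓒 p).map_source hp, by rwa [mem_preimage, (𝓒 p).left_inv hp]⟩

theorem transition_extChartAt (hp : x ∈ (𝓒 p).source) : transition d p q (𝓒 p x) = 𝓒 q x := by
  rw [transition, Function.comp_apply, (𝓒 p).left_inv hp]

theorem extChartAt_symm_transition (hy : y ∈ overlap d p q) :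
    (𝓒 q).symm (transition d p q y) = (𝓒 p).symm y :=
  (𝓒 q).left_inv hy.2

theorem mapsTo_transition (p q : M) : MapsTo (transition d p q) (overlap d p q) (overlap d q p) :=
  fun y hy => ⟨(𝓒 q).map_source hy.2, by
    rw [mem_preimage, extChartAt_symm_transition hy]
    exact (𝓒 p).map_target hy.1⟩

theorem leftInvOn_transition (p q : M) :
    LeftInvOn (transition d q p) (transition d p q) (overlap d p q) := by
  intro y hy
  rw [transition, Function.comp_apply, extChartAt_symm_transition hy]
  exact (𝓒 p).right_inv hy.1

variable [IsManifold (𝓡∂ (d + 1)) ω M]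

theorem isCoordChange_transition (p q : M) :
    IsCoordChange (halfSpace d) (overlap d p q) (overlap d q p)
      (transition d p q) (transition d q p) where
  relOpen_source := isRelOpen_overlap p q
  relOpen_target := isRelOpen_overlap q p
  mapsTo := mapsTo_transition p q
  mapsTo_inv := mapsTo_transition q p
  leftInv := leftInvOn_transition p q
  rightInv := leftInvOn_transition q p
  contDiffOn := (contDiffOn_ext_coord_change (n := ω) q p).of_le le_top
  contDiffOn_inv := (contDiffOn_ext_coord_change (n := ω) p q).of_le le_top

theorem contDiffOn_comp_extChartAt_symm {f : M → ℝ} (hf : ContMDiff (𝓡∂ (d + 1)) 𝓘(ℝ, ℝ) ω f)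
    (p : M) : ContDiffOn ℝ ω (f ∘ (𝓒 p).symm) (𝓒 p).target :=
  contMDiffOn_iff_contDiffOn.1 (hf.comp_contMDiffOn (contMDiffOn_extChartAt_symm p))

/-- The differential of the inverse of the preferred chart at `p`, which sends `∂_i` to the
corresponding tangent vector of `M`. -/
noncomputable def chartFrame (d : ℕ) {M : Type*} [TopologicalSpace M]
    [ChartedSpace (EuclideanHalfSpace (d + 1)) M] (p : M) (y : 𝔼(d + 1)) :
    𝔼(d + 1) →L[ℝ] 𝔼(d + 1) :=
  mfderivWithin 𝓘(ℝ, 𝔼(d + 1)) (𝓡∂ (d + 1)) (extChartAt (𝓡∂ (d + 1)) p).symm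
    (range (𝓡∂ (d + 1))) y

theorem chartFrame_injective (p : M) (hy : y ∈ (𝓒 p).target) :
    Function.Injective (chartFrame d p y) := by
  have : IsManifold (𝓡∂ (d + 1)) 1 M := IsManifold.of_le (n := ω) le_top
  exact (isInvertible_mfderivWithin_extChartAt_symm hy).injective

theorem chartFrame_transition (hy : y ∈ overlap d p q) :
    chartFrame d p y = (chartFrame d q (transition d p q y)).comp
      (fderivWithin ℝ (transition d p q) (overlap d p q) y) := by
  have : IsManifold (𝓡∂ (d + 1)) 1 M := IsManifold.of_le (n := ω) le_top
  have h := isCoordChange_transition (d := d) p q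
  have hrange : overlap d p q =ᶠ[𝓝 y] range (𝓡∂ (d + 1)) := by
    rw [range_model_eq_halfSpace]
    exact h.relOpen_source.eventuallyEq hy
  have chain_rule := mfderivWithin_comp y
    (mdifferentiableWithinAt_extChartAt_symm (h.mapsTo hy).1)
    (h.contDiffOn.differentiableOn (by simp) y hy).mdifferentiableWithinAt
    (fun z hz => extChartAt_target_subset_range q (h.mapsTo hz).1)
    (h.relOpen_source.uniqueDiffOn y hy).uniqueMDiffWithinAt
  rw [mfderivWithin_eq_fderivWithin] at chain_rule
  refine Eq.trans ?_ chain_rule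
  rw [chartFrame, ← mfderivWithin_congr_set hrange]
  exact (mfderivWithin_congr (fun z hz => extChartAt_symm_transition hz)
    (extChartAt_symm_transition hy)).symm

/-- The scalar product of the metric `g` at `x`, on the model space. -/
noncomputable def AnalyticMetric.form (g : AnalyticMetric d M) (x : M) :
    𝔼(d + 1) →L[ℝ] 𝔼(d + 1) →L[ℝ] ℝ :=
  g.inner x

theorem AnalyticMetric.form_comm (g : AnalyticMetric d M) (x : M) (v w : 𝔼(d + 1)) :
    g.form x v w = g.form x w v := g.symm x v w

theorem AnalyticMetric.form_self_pos (g : AnalyticMetric d M) (x : M) {v : 𝔼(d + 1)}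
    (hv : v ≠ 0) : 0 < g.form x v v := g.pos x v hv

theorem chartMetric_apply (g : AnalyticMetric d M) (p : M) (y : 𝔼(d + 1)) (i j : Fin (d + 1)) :
    chartMetric g p y i j = g.form ((𝓒 p).symm y) (chartFrame d p y (EuclideanSpace.single i 1))
      (chartFrame d p y (EuclideanSpace.single j 1)) := rfl

theorem form_chartFrame (g : AnalyticMetric d M) (p : M) (y v w : 𝔼(d + 1)) :
    g.form ((𝓒 p).symm y) (chartFrame d p y v) (chartFrame d p y w) =
      v.ofLp ⬝ᵥ Matrix.mulVec (chartMetric g p y) w.ofLp := by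
  have hsum : ∀ v : 𝔼(d + 1), v = ∑ i, v i • EuclideanSpace.single i 1 := fun v =>
    ((EuclideanSpace.basisFun (Fin (d + 1)) ℝ).sum_repr v).symm.trans (by simp)
  conv_lhs => rw [hsum v, hsum w]
  simp only [map_sum, map_smul, sum_apply, smul_apply, smul_eq_mul, dotProduct, Matrix.mulVec,
    Finset.mul_sum, ← chartMetric_apply]
  rw [Finset.sum_comm]
  exact Finset.sum_congr rfl fun i _ => Finset.sum_congr rfl fun j _ => by ring

theorem posDef_chartMetric (g : AnalyticMetric d M) (p : M) (hy : y ∈ (𝓒 p).target) :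
    (chartMetric g p y).PosDef := by
  refine Matrix.PosDef.of_dotProduct_mulVec_pos ?_ fun v hv => ?_
  · ext i j
    exact g.form_comm _ _ _
  · have hv' : chartFrame d p y (WithLp.toLp 2 v) ≠ 0 := by
      rw [Ne, map_eq_zero_iff _ (chartFrame_injective p hy)]
      simpa using hv
    exact (g.form_self_pos _ hv').trans_eq (form_chartFrame g p y _ _)

theorem chartMetric_eq_pullback (g : AnalyticMetric d M) (hy : y ∈ overlap d p q) :
    chartMetric g p y = pullbackMetric (overlap d p q) (transition d p q) (chartMetric g q) y := by
  ext i j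
  rw [chartMetric_apply, chartFrame_transition hy, ← extChartAt_symm_transition hy,
    pullbackMetric_apply]
  exact form_chartFrame g q _ _ _

theorem contMDiffOn_symmL_trivializationAt (p : M) (v : 𝔼(d + 1)) :
    ContMDiffOn (𝓡∂ (d + 1)) ((𝓡∂ (d + 1)).prod 𝓘(ℝ, 𝔼(d + 1))) ω
      (fun m : M => TotalSpace.mk' (𝔼(d + 1)) (E := (TangentSpace (𝓡∂ (d + 1)) : M → Type _)) m
        ((trivializationAt (𝔼(d + 1)) (TangentSpace (𝓡∂ (d + 1))) p).symmL ℝ m v))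
      (𝓒 p).source := by
  set e := trivializationAt (𝔼(d + 1)) (TangentSpace (𝓡∂ (d + 1)) : M → Type _) p with he
  have hsource : (𝓒 p).source = e.baseSet := by simp [he]
  rw [hsource, e.contMDiffOn_section_baseSet_iff]
  refine (contMDiffOn_const (c := v)).congr fun m hm => ?_
  rw [e.symmL_apply hm, e.apply_mk_symm hm]

theorem contMDiffOn_inner_symmL_trivializationAt (g : AnalyticMetric d M) (p : M)
    (v w : 𝔼(d + 1)) :
    ContMDiffOn (𝓡∂ (d + 1)) 𝓘(ℝ, ℝ) ω (fun m : M => g.inner m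
      ((trivializationAt (𝔼(d + 1)) (TangentSpace (𝓡∂ (d + 1))) p).symmL ℝ m v)
      ((trivializationAt (𝔼(d + 1)) (TangentSpace (𝓡∂ (d + 1))) p).symmL ℝ m w))
      (𝓒 p).source := by
  intro x hx
  have hsection := ContMDiffWithinAt.clm_bundle_apply₂ (F₁ := 𝔼(d + 1)) (F₂ := 𝔼(d + 1))
    (F₃ := ℝ) (E₃ := Bundle.Trivial M ℝ) (g.contMDiff x).contMDiffWithinAt
    (contMDiffOn_symmL_trivializationAt p v x hx) (contMDiffOn_symmL_trivializationAt p w x hx)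
  exact (contMDiffWithinAt_totalSpace.1 hsection).2

theorem contDiffOn_chartMetric (g : AnalyticMetric d M) (p : M) (i j : Fin (d + 1)) :
    ContDiffOn ℝ ω (fun y => chartMetric g p y i j) (𝓒 p).target := by
  have : IsManifold (𝓡∂ (d + 1)) 1 M := IsManifold.of_le (n := ω) le_top
  rw [← contMDiffOn_iff_contDiffOn]
  refine ((contMDiffOn_inner_symmL_trivializationAt g p (EuclideanSpace.single i 1)
    (EuclideanSpace.single j 1)).comp (contMDiffOn_extChartAt_symm p)
    (𝓒 p).mapsTo_symm).congr fun y hy => ?_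
  have symmL_eq := TangentBundle.symmL_trivializationAt (I := 𝓡∂ (d + 1))
    (by simpa only [extChartAt_source] using (𝓒 p).map_target hy)
  rw [(𝓒 p).right_inv hy] at symmL_eq
  rw [chartMetric_apply, Function.comp_apply, symmL_eq]
  rfl

theorem isLocalMetric_chartMetric (g : AnalyticMetric d M) (p : M) :
    IsLocalMetric (𝓒 p).target (chartMetric g p) :=
  ⟨fun i j => (contDiffOn_chartMetric g p i j).of_le le_top, fun _ hy => posDef_chartMetric g p hy⟩

end Charts

/-! ### Values of invariants on the manifold -/

section ValueAt

variable {d k n : ℕ} {M : Type*} [TopologicalSpace M] [ChartedSpace (EuclideanHalfSpace (d + 1)) M]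
  {Z : Set (𝔼(d + 1))} {P : LocalFormula (d + 1) k} {φ : Fin k → M → ℝ} {p q : M}

local notation "𝓒" => extChartAt (𝓡∂ (d + 1))

/-- The part of `M` which corresponds to the stratum `Z` in the charts: `M` itself for
`Z = univ`, and `∂M` for `Z = {x | x 0 = 0}`. -/
def stratumIn (M : Type*) [TopologicalSpace M] [ChartedSpace (EuclideanHalfSpace (d + 1)) M]
    (Z : Set (𝔼(d + 1))) : Set M :=
  {q | extChartAt (𝓡∂ (d + 1)) q q ∈ Z}

variable [IsManifold (𝓡∂ (d + 1)) ω M]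

theorem IsStratum.mem_stratumIn_iff (hZ : IsStratum Z) (hq : q ∈ (𝓒 p).source) :
    q ∈ stratumIn M Z ↔ 𝓒 p q ∈ Z := by
  refine hZ.mem_iff ?_
  rw [← transition_extChartAt (q := q) hq]
  exact (isCoordChange_transition p q).coord_eq_zero_iff
    (extChartAt_mem_overlap hq (mem_extChartAt_source q))

theorem IsStratum.isClosed_stratumIn (hZ : IsStratum Z) : IsClosed (stratumIn M Z) := by
  have hclosed : IsClosed Z := by
    rcases hZ with rfl | rfl
    · exact isClosed_univ
    · exact isClosed_eq (EuclideanSpace.proj (𝕜 := ℝ) (0 : Fin (d + 1))).continuous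
        continuous_const
  rw [← isOpen_compl_iff, isOpen_iff_mem_nhds]
  intro p hp
  filter_upwards [extChartAt_source_mem_nhds (I := 𝓡∂ (d + 1)) p,
    (continuousAt_extChartAt (I := 𝓡∂ (d + 1)) p).preimage_mem_nhds
      (hclosed.isOpen_compl.mem_nhds hp)] with q hq hqZ
  rwa [mem_compl_iff, hZ.mem_stratumIn_iff hq]

theorem LocalFormula.IsStratumInvariant.valueAt_eq (hP : P.IsStratumInvariant Z n)
    (g : AnalyticMetric d M) (hφ : ∀ μ, ContMDiff (𝓡∂ (d + 1)) 𝓘(ℝ, ℝ) ω (φ μ))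
    (hq : q ∈ (𝓒 p).source) (hqZ : q ∈ stratumIn M Z) :
    P.valueAt g φ q =
      P.value (𝓒 p).target (chartMetric g p) (fun μ => φ μ ∘ (𝓒 p).symm) (𝓒 p q) := by
  have hqp := extChartAt_mem_overlap (mem_extChartAt_source (I := 𝓡∂ (d + 1)) q) hq
  have hpq := extChartAt_mem_overlap hq (mem_extChartAt_source (I := 𝓡∂ (d + 1)) q)
  have hinv := hP.isInvariant _ _ _ _ (isCoordChange_transition q p) (chartMetric g p)
    ((isLocalMetric_chartMetric g p).mono inter_subset_left) (fun μ => φ μ ∘ (𝓒 p).symm)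
    (fun μ => ((contDiffOn_comp_extChartAt_symm (hφ μ) p).of_le le_top).mono inter_subset_left)
    _ ⟨hqp, hqZ⟩
  rw [transition_extChartAt (mem_extChartAt_source q),
    P.value_congr_set (overlap_eventuallyEq hpq)] at hinv
  rw [← hinv, LocalFormula.valueAt, ← P.value_congr_set (overlap_eventuallyEq hqp)]
  refine P.value_congr (fun z hz => chartMetric_eq_pullback g hz) (fun μ z hz => ?_) hqp
  simp only [Function.comp_apply, extChartAt_symm_transition hz]

theorem LocalFormula.IsStratumInvariant.continuousOn_valueAt (hP : P.IsStratumInvariant Z n)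
    (g : AnalyticMetric d M) (hφ : ∀ μ, ContMDiff (𝓡∂ (d + 1)) 𝓘(ℝ, ℝ) ω (φ μ)) :
    ContinuousOn (P.valueAt g φ) (stratumIn M Z) := by
  intro p hp
  have hchart : ContinuousOn (P.value (𝓒 p).target (chartMetric g p)
      (fun μ => φ μ ∘ (𝓒 p).symm) ∘ 𝓒 p) (𝓒 p).source :=
    (P.continuousOn_value hP.continuousOn_coeff (isLocalMetric_chartMetric g p)
      (fun μ => (contDiffOn_comp_extChartAt_symm (hφ μ) p).of_le le_top)
      (isRelOpen_extChartAt_target p).uniqueDiffOn).comp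
      (continuousOn_extChartAt (I := 𝓡∂ (d + 1)) p) (𝓒 p).mapsTo
  refine (hchart.continuousAt (extChartAt_source_mem_nhds p)).continuousWithinAt
    |>.congr_of_eventuallyEq ?_ (hP.valueAt_eq g hφ (mem_extChartAt_source p) hp)
  filter_upwards [self_mem_nhdsWithin, mem_nhdsWithin_of_mem_nhds
    (extChartAt_source_mem_nhds (I := 𝓡∂ (d + 1)) p)] with q hqZ hq
  exact hP.valueAt_eq g hφ hq hqZ

/-- The constant `C` satisfies the pointwise estimate `|P| ≤ κ(P) Cⁿ` at `q`, simultaneously for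
the interior and the boundary invariants `P` of all degrees `n`. -/
def AnalyticMetric.BoundsInvariantsAt (g : AnalyticMetric d M) (φ : Fin k → M → ℝ) (C : ℝ)
    (q : M) : Prop :=
  ∀ (Z : Set (𝔼(d + 1))) (n : ℕ) (P : LocalFormula (d + 1) k), P.IsStratumInvariant Z n →
    q ∈ stratumIn M Z → (n ≠ 0 ∨ ∀ μ x, |φ μ x| ≤ 1) → |P.valueAt g φ q| ≤ P.kappa * C ^ n

theorem AnalyticMetric.BoundsInvariantsAt.mono {g : AnalyticMetric d M} {C C' : ℝ} (hC : 0 < C)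
    (hCC' : C ≤ C') (h : g.BoundsInvariantsAt φ C q) : g.BoundsInvariantsAt φ C' q :=
  fun Z n P hP hq h0 => (h Z n P hP hq h0).trans <|
    mul_le_mul_of_nonneg_left (pow_le_pow_left₀ hC.le hCC' n) P.kappa_pos.le

theorem AnalyticMetric.exists_eventually_boundsInvariantsAt (g : AnalyticMetric d M)
    (hφ : ∀ μ, ContMDiff (𝓡∂ (d + 1)) 𝓘(ℝ, ℝ) ω (φ μ)) (p : M) :
    ∃ C : ℝ, 0 < C ∧ ∀ᶠ q in 𝓝 p, g.BoundsInvariantsAt φ C q := by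
  obtain ⟨C, hC, hbound⟩ := exists_eventually_abs_value_le (isRelOpen_extChartAt_target p)
    (contDiffOn_chartMetric g p) (fun y hy => posDef_chartMetric g p hy)
    (fun μ => contDiffOn_comp_extChartAt_symm (hφ μ) p)
    ((𝓒 p).map_source (mem_extChartAt_source p))
  have htendsto : Filter.Tendsto (𝓒 p) (𝓝 p) (𝓝[(𝓒 p).target] (𝓒 p p)) :=
    tendsto_nhdsWithin_iff.2 ⟨continuousAt_extChartAt p,
      Filter.mem_of_superset (extChartAt_source_mem_nhds p) (𝓒 p).mapsTo⟩
  refine ⟨C, hC, ?_⟩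
  filter_upwards [htendsto.eventually hbound, extChartAt_source_mem_nhds (I := 𝓡∂ (d + 1)) p]
    with q hbound hq Z n P hP hqZ h0
  rw [hP.valueAt_eq g hφ hq hqZ]
  exact hbound Z n P hP ((hP.isStratum.mem_stratumIn_iff hq).1 hqZ)
    (h0.imp_right fun h μ => h μ _)

theorem exists_forall_of_forall_exists_eventually {X : Type*} [TopologicalSpace X]
    [CompactSpace X] {Q : ℝ → X → Prop}
    (mono : ∀ {C C' : ℝ} {q : X}, 0 < C → C ≤ C' → Q C q → Q C' q)
    (h : ∀ p, ∃ C : ℝ, 0 < C ∧ ∀ᶠ q in 𝓝 p, Q C q) : ∃ C : ℝ, 0 < C ∧ ∀ q, Q C q := by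
  have hcompact : ∃ C : ℝ, 0 < C ∧ ∀ q ∈ (univ : Set X), Q C q := by
    refine isCompact_univ.induction_on (p := fun S => ∃ C : ℝ, 0 < C ∧ ∀ q ∈ S, Q C q)
      ⟨1, one_pos, by simp⟩ ?_ ?_ ?_
    · rintro S T hST ⟨C, hC, hQ⟩
      exact ⟨C, hC, fun q hq => hQ q (hST hq)⟩
    · rintro S T ⟨C, hC, hQ⟩ ⟨C', hC', hQ'⟩
      refine ⟨max C C', lt_max_of_lt_left hC, fun q hq => hq.elim ?_ ?_⟩
      · exact fun hq => mono hC (le_max_left _ _) (hQ q hq)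
      · exact fun hq => mono hC' (le_max_right _ _) (hQ' q hq)
    · intro p _
      obtain ⟨C, hC, hQ⟩ := h p
      exact ⟨_, mem_nhdsWithin_of_mem_nhds hQ, C, hC, fun q hq => hq⟩
  simpa only [mem_univ, true_implies] using hcompact

theorem AnalyticMetric.exists_boundsInvariantsAt [CompactSpace M] (g : AnalyticMetric d M)
    (hφ : ∀ μ, ContMDiff (𝓡∂ (d + 1)) 𝓘(ℝ, ℝ) ω (φ μ)) :
    ∃ C : ℝ, 0 < C ∧ ∀ q, g.BoundsInvariantsAt φ C q :=
  exists_forall_of_forall_exists_eventually AnalyticMetric.BoundsInvariantsAt.mono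
    (g.exists_eventually_boundsInvariantsAt hφ)

end ValueAt

/-! ### Rescaling the metric -/

section Rescaling

variable {d k n : ℕ} {M : Type*} [TopologicalSpace M] [ChartedSpace (EuclideanHalfSpace (d + 1)) M]
  [IsManifold (𝓡∂ (d + 1)) ω M] {φ : Fin k → M → ℝ}

theorem AnalyticMetric.ext_inner {g h : AnalyticMetric d M} (hgh : g.inner = h.inner) : g = h := by
  cases g
  cases h
  cases hgh
  rfl

theorem AnalyticMetric.scale_scale (g : AnalyticMetric d M) {a b c : ℝ} (ha : 0 < a)
    (hb : 0 < b) (hc : 0 < c) (h : b * a = c) : (g.scale a ha).scale b hb = g.scale c hc := by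
  refine AnalyticMetric.ext_inner (funext fun x => ?_)
  change b ^ 2 • a ^ 2 • g.inner x = c ^ 2 • g.inner x
  rw [smul_smul, ← mul_pow, h]

theorem AnalyticMetric.scale_one (g : AnalyticMetric d M) : g.scale 1 one_pos = g := by
  refine AnalyticMetric.ext_inner (funext fun x => ?_)
  change (1 : ℝ) ^ 2 • g.inner x = g.inner x
  rw [one_pow, one_smul]

theorem AnalyticMetric.form_scale (g : AnalyticMetric d M) {c : ℝ} (hc : 0 < c) (x : M)
    (v w : 𝔼(d + 1)) : (g.scale c hc).form x v w = c ^ 2 * g.form x v w := rfl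

theorem chartMetric_scale (g : AnalyticMetric d M) {c : ℝ} (hc : 0 < c) (p : M) :
    chartMetric (g.scale c hc) p = fun y => c ^ 2 • chartMetric g p y := by
  ext y i j
  rw [Matrix.smul_apply, chartMetric_apply, chartMetric_apply, g.form_scale, smul_eq_mul]

theorem LocalFormula.IsStratumInvariant.valueAt_scale {P : LocalFormula (d + 1) k}
    {Z : Set (𝔼(d + 1))} (hP : P.IsStratumInvariant Z n) (g : AnalyticMetric d M)
    (hφ : ∀ μ, ContMDiff (𝓡∂ (d + 1)) 𝓘(ℝ, ℝ) ω (φ μ)) {c : ℝ} (hc : 0 < c) {q : M}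
    (hq : q ∈ stratumIn M Z) :
    P.valueAt (g.scale c hc) φ q = c⁻¹ ^ n * P.valueAt g φ q := by
  rw [LocalFormula.valueAt, chartMetric_scale, LocalFormula.valueAt]
  exact hP.value_smul_metric (isRelOpen_extChartAt_target q) (isLocalMetric_chartMetric g q)
    (fun μ => (contDiffOn_comp_extChartAt_symm (hφ μ) q).of_le le_top)
    ((extChartAt (𝓡∂ (d + 1)) q).map_source (mem_extChartAt_source q)) hq hc

theorem AnalyticMetric.BoundsInvariantsAt.scale {g : AnalyticMetric d M} {C : ℝ} {q : M}
    (h : g.BoundsInvariantsAt φ C q) (hφ : ∀ μ, ContMDiff (𝓡∂ (d + 1)) 𝓘(ℝ, ℝ) ω (φ μ)) {c : ℝ}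
    (hc : 0 < c) : (g.scale c hc).BoundsInvariantsAt φ (c⁻¹ * C) q := by
  intro Z n P hP hq h0
  have hc' : 0 < c⁻¹ ^ n := by positivity
  rw [hP.valueAt_scale g hφ hc hq, abs_mul, abs_of_pos hc', mul_pow, mul_left_comm]
  exact mul_le_mul_of_nonneg_left (h Z n P hP hq h0) hc'.le

variable [Nonempty M]

/-- The `g`-length of a fixed non-zero tangent vector, by which metrics are normalized within
their scaling classes. -/
noncomputable def AnalyticMetric.gauge (g : AnalyticMetric d M) : ℝ :=
  Real.sqrt (g.form (Classical.arbitrary M) (EuclideanSpace.single 0 1)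
    (EuclideanSpace.single 0 1))

theorem AnalyticMetric.gauge_pos (g : AnalyticMetric d M) : 0 < g.gauge :=
  Real.sqrt_pos.2 (g.form_self_pos _ (by simp))

theorem AnalyticMetric.gauge_scale (g : AnalyticMetric d M) {c : ℝ} (hc : 0 < c) :
    (g.scale c hc).gauge = c * g.gauge := by
  rw [AnalyticMetric.gauge, g.form_scale, Real.sqrt_mul (sq_nonneg c), Real.sqrt_sq hc.le,
    AnalyticMetric.gauge]

/-- The metric of gauge `1` proportional to `g`. -/
noncomputable def AnalyticMetric.normalize (g : AnalyticMetric d M) : AnalyticMetric d M :=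
  g.scale g.gauge⁻¹ (inv_pos.2 g.gauge_pos)

theorem AnalyticMetric.normalize_scale_gauge (g : AnalyticMetric d M) :
    g.normalize.scale g.gauge g.gauge_pos = g := by
  rw [normalize, g.scale_scale _ _ one_pos (mul_inv_cancel₀ g.gauge_pos.ne'), g.scale_one]

theorem AnalyticMetric.normalize_scale (g : AnalyticMetric d M) {c : ℝ} (hc : 0 < c) :
    (g.scale c hc).normalize = g.normalize :=
  g.scale_scale _ _ _ (by rw [gauge_scale, mul_inv_rev, inv_mul_cancel_right₀ hc.ne'])

theorem exists_homogeneous_boundsInvariantsAt (d k : ℕ) (M : Type*) [TopologicalSpace M]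
    [CompactSpace M] [Nonempty M] [ChartedSpace (EuclideanHalfSpace (d + 1)) M]
    [IsManifold (𝓡∂ (d + 1)) ω M] :
    ∃ C : AnalyticMetric d M → (Fin k → M → ℝ) → ℝ, ∀ (g : AnalyticMetric d M)
      (φ : Fin k → M → ℝ), (∀ μ, ContMDiff (𝓡∂ (d + 1)) 𝓘(ℝ, ℝ) ω (φ μ)) →
      0 < C g φ ∧ (∀ q, g.BoundsInvariantsAt φ (C g φ) q) ∧
      ∀ (c : ℝ) (hc : 0 < c), C (g.scale c hc) φ = c⁻¹ * C g φ := by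
  choose! C hC hbound using fun (g : AnalyticMetric d M) (φ : Fin k → M → ℝ)
    (hφ : ∀ μ, ContMDiff (𝓡∂ (d + 1)) 𝓘(ℝ, ℝ) ω (φ μ)) => g.exists_boundsInvariantsAt hφ
  refine ⟨fun g φ => g.gauge⁻¹ * C g.normalize φ, fun g φ hφ =>
    ⟨mul_pos (inv_pos.2 g.gauge_pos) (hC _ φ hφ), fun q => ?_, fun c hc => ?_⟩⟩
  · have := (hbound g.normalize φ hφ q).scale hφ g.gauge_pos
    rwa [g.normalize_scale_gauge] at this
  · simp only [g.normalize_scale]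
    rw [g.gauge_scale, mul_inv, mul_assoc]

end Rescaling

/-! ### Suprema and images of measures -/

section Measure

variable {X Y : Type*} [MeasurableSpace X] [MeasurableSpace Y]

theorem restrict_iSup_le {ι : Type*} {μ : ι → Measure X} {ν : Measure X} {O : Set X}
    (hO : MeasurableSet O) (h : ∀ i, (μ i).restrict O ≤ ν) : (⨆ i, μ i).restrict O ≤ ν := by
  have hle : ⨆ i, μ i ≤ ν + (⨆ i, μ i).restrict Oᶜ := iSup_le fun i => by
    rw [← Measure.restrict_add_restrict_compl (μ := μ i) hO]
    exact add_le_add (h i) (Measure.restrict_mono subset_rfl (le_iSup μ i))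
  refine (Measure.restrict_mono subset_rfl hle).trans ?_
  rw [Measure.restrict_add, Measure.restrict_restrict hO, inter_compl_self,
    Measure.restrict_empty, add_zero]
  exact Measure.restrict_le_self

theorem iSup_measure_eq_zero {ι : Type*} {μ : ι → Measure X} {N : Set X} (hN : MeasurableSet N)
    (h : ∀ i, μ i N = 0) : (⨆ i, μ i) N = 0 :=
  Measure.restrict_eq_zero.1 <| Measure.nonpos_iff_eq_zero'.1 <|
    restrict_iSup_le hN fun i => (Measure.restrict_eq_zero.2 (h i)).le

theorem isLocallyFiniteMeasure_iSup [TopologicalSpace X] [OpensMeasurableSpace X]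
    {μ : X → Measure X} {O : X → Set X} (hO : ∀ p, IsOpen (O p)) (mem_O : ∀ p, p ∈ O p)
    (hμ : ∀ x p, (μ x).restrict (O p) ≤ μ p) (hfin : ∀ p, (μ p).FiniteAtFilter (𝓝 p)) :
    IsLocallyFiniteMeasure (⨆ x, μ x) where
  finiteAtNhds p := by
    obtain ⟨B, hB, hlt⟩ := hfin p
    refine ⟨B ∩ O p, Filter.inter_mem hB ((hO p).mem_nhds (mem_O p)), ?_⟩
    rw [← Measure.restrict_apply' (hO p).measurableSet]
    exact (restrict_iSup_le (hO p).measurableSet (fun x => hμ x p) B).trans_lt hlt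

variable [TopologicalSpace X] [OpensMeasurableSpace X] [TopologicalSpace Y] [BorelSpace Y]

theorem measurableSet_inter_preimage_of_continuousOn {f : X → Y} {S : Set X}
    (hf : ContinuousOn f S) (hS : MeasurableSet S) {D : Set Y} (hD : MeasurableSet D) :
    MeasurableSet (S ∩ f ⁻¹' D) := by
  rw [← Subtype.image_preimage_coe]
  exact hS.subtype_image ((continuousOn_iff_continuous_domRestrict.1 hf).measurable hD)

variable {μ : Measure X} {f : X → Y} {S : Set X} {w : X → ℝ≥0∞} {D : Set Y}

theorem map_withDensity_restrict_apply (hf : ContinuousOn f S) (hS : MeasurableSet S)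
    (hD : MeasurableSet D) :
    ((μ.restrict S).withDensity w).map f D = ∫⁻ z in S ∩ f ⁻¹' D, w z ∂μ := by
  have hmap : AEMeasurable f ((μ.restrict S).withDensity w) :=
    (hf.aemeasurable hS).mono_ac (withDensity_absolutelyContinuous _ _)
  rw [Measure.map_apply_of_aemeasurable hmap hD, ← restrict_withDensity hS,
    Measure.restrict_apply' hS, inter_comm,
    withDensity_apply _ (measurableSet_inter_preimage_of_continuousOn hf hS hD)]

theorem map_withDensity_restrict_lt_top (hf : ContinuousOn f S) (hS : MeasurableSet S)
    (hD : MeasurableSet D) {K : Set X} (hK : μ K < ⊤) {c : ℝ≥0∞} (hc : c < ⊤)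
    (h : ∀ z ∈ S, f z ∈ D → z ∈ K ∧ w z ≤ c) :
    ((μ.restrict S).withDensity w).map f D < ⊤ := by
  rw [map_withDensity_restrict_apply hf hS hD]
  refine (setLIntegral_mono' (measurableSet_inter_preimage_of_continuousOn hf hS hD)
    fun z hz => (h z hz.1 hz.2).2).trans_lt ?_
  rw [setLIntegral_const]
  exact ENNReal.mul_lt_top hc ((measure_mono fun z hz => (h z hz.1 hz.2).1).trans_lt hK)

theorem restrict_map_withDensity_restrict_le {F : Type*} [NormedAddCommGroup F]
    [NormedSpace ℝ F] [FiniteDimensional ℝ F] [MeasurableSpace F] [BorelSpace F]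
    {μ : Measure F} [μ.IsAddHaarMeasure] {a b : F → Y} {S T : Set F} {w u : F → ℝ≥0∞}
    (ha : ContinuousOn a S) (hS : MeasurableSet S) (hb : ContinuousOn b T) (hT : MeasurableSet T)
    {O : Set Y} (hO : MeasurableSet O) {τ : F → F} {τ' : F → F →L[ℝ] F}
    (hτ : ∀ z ∈ S ∩ a ⁻¹' O, HasFDerivWithinAt τ (τ' z) (S ∩ a ⁻¹' O) z)
    (hinj : InjOn τ (S ∩ a ⁻¹' O)) (hmaps : MapsTo τ (S ∩ a ⁻¹' O) T)
    (hab : ∀ z ∈ S ∩ a ⁻¹' O, b (τ z) = a z)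
    (hw : ∀ z ∈ S ∩ a ⁻¹' O, w z = ENNReal.ofReal |(τ' z).det| * u (τ z)) :
    (((μ.restrict S).withDensity w).map a).restrict O ≤ ((μ.restrict T).withDensity u).map b := by
  refine Measure.le_iff.2 fun A hA => ?_
  rw [Measure.restrict_apply hA, map_withDensity_restrict_apply ha hS (hA.inter hO),
    map_withDensity_restrict_apply hb hT hA]
  have hsub : S ∩ a ⁻¹' (A ∩ O) ⊆ S ∩ a ⁻¹' O := fun z hz => ⟨hz.1, hz.2.2⟩
  have hmeas := measurableSet_inter_preimage_of_continuousOn ha hS (hA.inter hO)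
  calc ∫⁻ z in S ∩ a ⁻¹' (A ∩ O), w z ∂μ
      = ∫⁻ z in S ∩ a ⁻¹' (A ∩ O), ENNReal.ofReal |(τ' z).det| * u (τ z) ∂μ :=
        setLIntegral_congr_fun hmeas fun z hz => hw z (hsub hz)
    _ = ∫⁻ z in τ '' (S ∩ a ⁻¹' (A ∩ O)), u z ∂μ :=
        (lintegral_image_eq_lintegral_abs_det_fderiv_mul μ hmeas
          (fun z hz => (hτ z (hsub hz)).mono hsub) (hinj.mono hsub) u).symm
    _ ≤ ∫⁻ z in T ∩ b ⁻¹' A, u z ∂μ := by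
        refine lintegral_mono_set (image_subset_iff.2 fun z hz => ⟨hmaps (hsub hz), ?_⟩)
        rw [mem_preimage, hab z (hsub hz)]
        exact hz.2.1

end Measure

/-! ### The boundary in charts -/

section Boundary

open Matrix

variable {d : ℕ} {M : Type*} [TopologicalSpace M] [ChartedSpace (EuclideanHalfSpace (d + 1)) M]
  {p q : M} {z : 𝔼 d}

local notation "𝓒" => extChartAt (𝓡∂ (d + 1))

/-- `boundaryIncl` as a continuous linear map. -/
noncomputable def boundaryInclL (d : ℕ) : 𝔼 d →L[ℝ] 𝔼(d + 1) :=
  LinearMap.toContinuousLinearMap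
    { toFun := boundaryIncl d
      map_add' := fun v w => by
        ext i
        refine Fin.cases ?_ (fun i => ?_) i <;> simp [boundaryIncl]
      map_smul' := fun c v => by
        ext i
        refine Fin.cases ?_ (fun i => ?_) i <;> simp [boundaryIncl] }

/-- The projection to the boundary hyperplane, which forgets the coordinate `x 0`. -/
noncomputable def boundaryProj (d : ℕ) : 𝔼(d + 1) →L[ℝ] 𝔼 d :=
  LinearMap.toContinuousLinearMap
    { toFun := fun v => WithLp.toLp 2 fun i => v i.succ
      map_add' := fun _ _ => rfl
      map_smul' := fun _ _ => rfl }

theorem boundaryProj_apply (v : 𝔼(d + 1)) (i : Fin d) : boundaryProj d v i = v i.succ := rfl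

theorem boundaryIncl_zero (z : 𝔼 d) : boundaryIncl d z 0 = 0 := rfl

theorem boundaryIncl_succ (z : 𝔼 d) (i : Fin d) : boundaryIncl d z i.succ = z i := rfl

theorem norm_boundaryIncl (z : 𝔼 d) : ‖boundaryIncl d z‖ = ‖z‖ := by
  simp [EuclideanSpace.norm_eq, Fin.sum_univ_succ, boundaryIncl_zero, boundaryIncl_succ]

theorem boundaryProj_boundaryIncl (z : 𝔼 d) : boundaryProj d (boundaryIncl d z) = z := rfl

theorem boundaryIncl_boundaryProj {v : 𝔼(d + 1)} (hv : v 0 = 0) :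
    boundaryIncl d (boundaryProj d v) = v := by
  ext i
  refine Fin.cases ?_ (fun i => ?_) i
  · rw [boundaryIncl_zero, hv]
  · rw [boundaryIncl_succ, boundaryProj_apply]

theorem boundaryIncl_single (i : Fin d) :
    boundaryIncl d (EuclideanSpace.single i 1) = EuclideanSpace.single i.succ 1 := by
  ext j
  refine Fin.cases ?_ (fun j => ?_) j
  · simp [boundaryIncl_zero]
  · simp [boundaryIncl_succ]

theorem continuous_boundaryIncl : Continuous (boundaryIncl d) := (boundaryInclL d).continuous

theorem dotProduct_mulVec_boundaryIncl (A : Matrix (Fin (d + 1)) (Fin (d + 1)) ℝ) (v w : 𝔼 d) :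
    (boundaryIncl d v).ofLp ⬝ᵥ A *ᵥ (boundaryIncl d w).ofLp =
      v.ofLp ⬝ᵥ A.submatrix Fin.succ Fin.succ *ᵥ w.ofLp := by
  simp [dotProduct, mulVec, Fin.sum_univ_succ, boundaryIncl_zero, boundaryIncl_succ]

theorem sqrt_det_pullbackMetric {m : ℕ} {U : Set (𝔼 m)} {ψ : 𝔼 m → 𝔼 m}
    {G : 𝔼 m → Matrix (Fin m) (Fin m) ℝ} (x : 𝔼 m) :
    Real.sqrt (pullbackMetric U ψ G x).det =
      |(fderivWithin ℝ ψ U x).det| * Real.sqrt (G (ψ x)).det := by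
  rw [pullbackMetric_eq, det_mul, det_mul, det_transpose, mul_right_comm, ← pow_two,
    Real.sqrt_mul (sq_nonneg _), Real.sqrt_sq_eq_abs, det_jacobian]

theorem continuousOn_extChartAt_symm_comp_boundaryIncl (p : M) :
    ContinuousOn ((𝓒 p).symm ∘ boundaryIncl d) (boundaryIncl d ⁻¹' (𝓒 p).target) :=
  (continuousOn_extChartAt_symm p).comp continuous_boundaryIncl.continuousOn fun _ hz => hz

theorem measurableSet_boundaryIncl_preimage (p : M) :
    MeasurableSet (boundaryIncl d ⁻¹' (𝓒 p).target) :=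
  continuous_boundaryIncl.measurable (isRelOpen_extChartAt_target p).measurableSet

/-- The domain of the change of boundary coordinates between the preferred charts at `p` and
`q`. -/
def boundaryOverlap (d : ℕ) {M : Type*} [TopologicalSpace M]
    [ChartedSpace (EuclideanHalfSpace (d + 1)) M] (p q : M) : Set (𝔼 d) :=
  boundaryIncl d ⁻¹' overlap d p q

/-- The change of boundary coordinates between the preferred charts at `p` and `q`. -/
noncomputable def boundaryTransition (d : ℕ) {M : Type*} [TopologicalSpace M]
    [ChartedSpace (EuclideanHalfSpace (d + 1)) M] (p q : M) : 𝔼 d → 𝔼 d :=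
  boundaryProj d ∘ transition d p q ∘ boundaryIncl d

theorem isOpen_boundaryOverlap (p q : M) : IsOpen (boundaryOverlap d p q) := by
  obtain ⟨O, hO, hO'⟩ := isRelOpen_overlap (d := d) p q
  have hhalf : boundaryIncl d ⁻¹' halfSpace d = univ :=
    eq_univ_of_forall fun z => (boundaryIncl_zero z).ge
  rw [boundaryOverlap, hO', preimage_inter, hhalf, inter_univ]
  exact hO.preimage continuous_boundaryIncl

variable [IsManifold (𝓡∂ (d + 1)) ω M]

theorem boundaryIncl_boundaryTransition (hz : z ∈ boundaryOverlap d p q) :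
    boundaryIncl d (boundaryTransition d p q z) = transition d p q (boundaryIncl d z) :=
  boundaryIncl_boundaryProj
    (((isCoordChange_transition p q).coord_eq_zero_iff hz).2 (boundaryIncl_zero z))

theorem injOn_boundaryTransition (p q : M) :
    InjOn (boundaryTransition d p q) (boundaryOverlap d p q) := by
  intro z hz w hw hzw
  have htransition : transition d p q (boundaryIncl d z) = transition d p q (boundaryIncl d w) := by
    rw [← boundaryIncl_boundaryTransition hz, hzw, boundaryIncl_boundaryTransition hw]
  rw [← boundaryProj_boundaryIncl z, (leftInvOn_transition p q).injOn hz hw htransition,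
    boundaryProj_boundaryIncl]

theorem hasFDerivWithinAt_transition_comp_boundaryIncl (hz : z ∈ boundaryOverlap d p q) :
    HasFDerivWithinAt (transition d p q ∘ boundaryIncl d)
      ((fderivWithin ℝ (transition d p q) (overlap d p q) (boundaryIncl d z)).comp
        (boundaryInclL d)) (boundaryOverlap d p q) z :=
  ((isCoordChange_transition p q).hasFDerivWithinAt hz).comp z
    (boundaryInclL d).hasFDerivWithinAt fun _ hy => hy

theorem hasFDerivWithinAt_boundaryTransition (hz : z ∈ boundaryOverlap d p q) :
    HasFDerivWithinAt (boundaryTransition d p q)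
      (fderivWithin ℝ (boundaryTransition d p q) (boundaryOverlap d p q) z)
      (boundaryOverlap d p q) z :=
  ((boundaryProj d).hasFDerivAt.comp_hasFDerivWithinAt z
    (hasFDerivWithinAt_transition_comp_boundaryIncl hz)).differentiableWithinAt.hasFDerivWithinAt

theorem fderivWithin_transition_boundaryIncl (hz : z ∈ boundaryOverlap d p q) (v : 𝔼 d) :
    fderivWithin ℝ (transition d p q) (overlap d p q) (boundaryIncl d z) (boundaryIncl d v) =
      boundaryIncl d
        (fderivWithin ℝ (boundaryTransition d p q) (boundaryOverlap d p q) z v) := by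
  have hincl := ((boundaryInclL d).hasFDerivAt.comp_hasFDerivWithinAt z
    (hasFDerivWithinAt_boundaryTransition hz)).congr
    (fun y hy => (boundaryIncl_boundaryTransition hy).symm)
    (boundaryIncl_boundaryTransition hz).symm
  exact DFunLike.congr_fun (((isOpen_boundaryOverlap p q).uniqueDiffWithinAt hz).eq
    (hasFDerivWithinAt_transition_comp_boundaryIncl hz) hincl) v

/-- The matrix `(g_{ij})_{i, j ≥ 1}` of the restriction of `g` to the boundary, in the preferred
chart at `p`. -/
noncomputable def boundaryChartMetric (g : AnalyticMetric d M) (p : M) (z : 𝔼 d) :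
    Matrix (Fin d) (Fin d) ℝ :=
  (chartMetric g p (boundaryIncl d z)).submatrix Fin.succ Fin.succ

theorem boundaryChartMetric_eq_pullback (g : AnalyticMetric d M)
    (hz : z ∈ boundaryOverlap d p q) :
    boundaryChartMetric g p z = pullbackMetric (boundaryOverlap d p q) (boundaryTransition d p q)
      (boundaryChartMetric g q) z := by
  ext i j
  rw [boundaryChartMetric, submatrix_apply, chartMetric_eq_pullback g hz, pullbackMetric_apply,
    pullbackMetric_apply, ← boundaryIncl_single, ← boundaryIncl_single,
    fderivWithin_transition_boundaryIncl hz, fderivWithin_transition_boundaryIncl hz,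
    dotProduct_mulVec_boundaryIncl, boundaryChartMetric, boundaryIncl_boundaryTransition hz]

end Boundary

/-! ### The Riemannian measures -/

section Volume

variable {d : ℕ} {M : Type*} [TopologicalSpace M] [ChartedSpace (EuclideanHalfSpace (d + 1)) M]

local notation "𝓒" => extChartAt (𝓡∂ (d + 1))

theorem finiteAtFilter_map_withDensity_extChartAt_symm [MeasurableSpace M] [BorelSpace M]
    {e : ℕ} {ι : 𝔼 e → 𝔼(d + 1)} (hι : Continuous ι) (hnorm : ∀ z, ‖ι z‖ = ‖z‖) (p : M)
    {W : 𝔼(d + 1) → ℝ} (hW : ContinuousOn W (𝓒 p).target) :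
    (((volume.restrict (ι ⁻¹' (𝓒 p).target)).withDensity fun z => ENNReal.ofReal (W (ι z))).map
      ((𝓒 p).symm ∘ ι)).FiniteAtFilter (𝓝 p) := by
  have hWp : ContinuousAt (W ∘ 𝓒 p) p :=
    (hW.comp (continuousOn_extChartAt p) (𝓒 p).mapsTo).continuousAt (extChartAt_source_mem_nhds p)
  have hnear : ∀ᶠ x in 𝓝 p, W (𝓒 p x) < W (𝓒 p p) + 1 ∧ ‖𝓒 p x‖ < ‖𝓒 p p‖ + 1 :=
    (hWp.eventually_lt_const (lt_add_one _)).and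
      ((continuousAt_extChartAt p).norm.eventually_lt_const (lt_add_one _))
  obtain ⟨B, hB, hB_open, hpB⟩ := eventually_nhds_iff.1 hnear
  refine ⟨B, hB_open.mem_nhds hpB, map_withDensity_restrict_lt_top
    ((continuousOn_extChartAt_symm p).comp hι.continuousOn fun z hz => hz)
    (hι.measurable (isRelOpen_extChartAt_target p).measurableSet) hB_open.measurableSet
    (measure_ball_lt_top (x := 0) (r := ‖𝓒 p p‖ + 1)) (ENNReal.ofReal_lt_top (r := W (𝓒 p p) + 1))
    fun z hz hzB => ?_⟩
  have hz' := hB _ hzB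
  rw [Function.comp_apply, (𝓒 p).right_inv hz, hnorm] at hz'
  exact ⟨mem_ball_zero_iff.2 hz'.2, ENNReal.ofReal_le_ofReal hz'.1.le⟩

variable [IsManifold (𝓡∂ (d + 1)) ω M]

theorem continuousOn_sqrt_det_submatrix_chartMetric (g : AnalyticMetric d M) (p : M) {e : ℕ}
    (f : Fin e → Fin (d + 1)) :
    ContinuousOn (fun y => Real.sqrt ((chartMetric g p y).submatrix f f).det) (𝓒 p).target :=
  (continuous_id.matrix_submatrix f f).matrix_det.sqrt.comp_continuousOn
    (isLocalMetric_chartMetric g p).continuousOn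

variable [MeasurableSpace M] {k n : ℕ} {P : LocalFormula (d + 1) k} {Z : Set (𝔼(d + 1))}
  {φ : Fin k → M → ℝ} {μ : Measure M} [IsFiniteMeasure μ]

theorem riemannianVolume_compl_stratumIn_univ (g : AnalyticMetric d M) :
    riemannianVolume g (stratumIn M (univ : Set (𝔼(d + 1))))ᶜ = 0 := by
  simp [stratumIn]

theorem LocalFormula.IsStratumInvariant.abs_integral_valueAt_le (hP : P.IsStratumInvariant Z n)
    {g : AnalyticMetric d M} {C : ℝ} (hbound : ∀ q, g.BoundsInvariantsAt φ C q)
    (hμ : μ (stratumIn M Z)ᶜ = 0) (h0 : n ≠ 0 ∨ ∀ μ x, |φ μ x| ≤ 1) :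
    |∫ x, P.valueAt g φ x ∂μ| ≤ P.kappa * C ^ n * μ.real univ := by
  refine norm_integral_le_of_norm_le_const (f := P.valueAt g φ) ?_
  filter_upwards [mem_ae_iff.2 hμ] with q hq using hbound q Z n P hP hq h0

variable [BorelSpace M]

theorem restrict_chartVolume_le (g : AnalyticMetric d M) (x p : M) :
    (chartVolume g x).restrict (𝓒 p).source ≤ chartVolume g p := by
  have h := isCoordChange_transition (d := d) x p
  refine restrict_map_withDensity_restrict_le (continuousOn_extChartAt_symm x)
    (isRelOpen_extChartAt_target x).measurableSet (continuousOn_extChartAt_symm p)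
    (isRelOpen_extChartAt_target p).measurableSet (isOpen_extChartAt_source p).measurableSet
    (fun z hz => h.hasFDerivWithinAt hz) h.leftInv.injOn (fun z hz => (h.mapsTo hz).1)
    (fun z hz => extChartAt_symm_transition hz) fun z hz => ?_
  rw [chartMetric_eq_pullback g hz, sqrt_det_pullbackMetric, ENNReal.ofReal_mul (abs_nonneg _)]

theorem restrict_chartBoundaryVolume_le (g : AnalyticMetric d M) (x p : M) :
    (chartBoundaryVolume g x).restrict (𝓒 p).source ≤ chartBoundaryVolume g p := by
  refine restrict_map_withDensity_restrict_le
    (continuousOn_extChartAt_symm_comp_boundaryIncl x) (measurableSet_boundaryIncl_preimage x)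
    (continuousOn_extChartAt_symm_comp_boundaryIncl p) (measurableSet_boundaryIncl_preimage p)
    (isOpen_extChartAt_source p).measurableSet
    (fun z hz => hasFDerivWithinAt_boundaryTransition (d := d) (p := x) (q := p) hz)
    (injOn_boundaryTransition x p) (fun z hz => ?_) (fun z hz => ?_) fun z hz => ?_
  · rw [mem_preimage, boundaryIncl_boundaryTransition hz]
    exact (mapsTo_transition x p hz).1
  · rw [Function.comp_apply, boundaryIncl_boundaryTransition hz]
    exact extChartAt_symm_transition hz
  · change ENNReal.ofReal (Real.sqrt (boundaryChartMetric g x z).det) = _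
    rw [boundaryChartMetric_eq_pullback g hz, sqrt_det_pullbackMetric,
      ENNReal.ofReal_mul (abs_nonneg _)]
    rfl

theorem finiteAtFilter_chartVolume (g : AnalyticMetric d M) (p : M) :
    (chartVolume g p).FiniteAtFilter (𝓝 p) := by
  simpa only [chartVolume, preimage_id, Function.comp_id, id, Matrix.submatrix_id_id] using
    finiteAtFilter_map_withDensity_extChartAt_symm continuous_id (fun _ => rfl) p
      (continuousOn_sqrt_det_submatrix_chartMetric g p id)

theorem finiteAtFilter_chartBoundaryVolume (g : AnalyticMetric d M) (p : M) :
    (chartBoundaryVolume g p).FiniteAtFilter (𝓝 p) := by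
  rw [chartBoundaryVolume]
  exact finiteAtFilter_map_withDensity_extChartAt_symm continuous_boundaryIncl norm_boundaryIncl p
    (W := fun y => Real.sqrt ((chartMetric g p y).submatrix Fin.succ Fin.succ).det)
    (continuousOn_sqrt_det_submatrix_chartMetric g p Fin.succ)

theorem isLocallyFiniteMeasure_riemannianVolume (g : AnalyticMetric d M) :
    IsLocallyFiniteMeasure (riemannianVolume g) :=
  isLocallyFiniteMeasure_iSup (μ := chartVolume g) (O := fun p => (𝓒 p).source)
    isOpen_extChartAt_source mem_extChartAt_source (restrict_chartVolume_le g)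
    (finiteAtFilter_chartVolume g)

theorem isLocallyFiniteMeasure_riemannianBoundaryVolume (g : AnalyticMetric d M) :
    IsLocallyFiniteMeasure (riemannianBoundaryVolume g) :=
  isLocallyFiniteMeasure_iSup (μ := chartBoundaryVolume g) (O := fun p => (𝓒 p).source)
    isOpen_extChartAt_source mem_extChartAt_source (restrict_chartBoundaryVolume_le g)
    (finiteAtFilter_chartBoundaryVolume g)

theorem riemannianBoundaryVolume_compl_boundary (g : AnalyticMetric d M) :
    riemannianBoundaryVolume g (stratumIn M {y : 𝔼(d + 1) | y 0 = 0})ᶜ = 0 := by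
  have hZ : IsStratum {y : 𝔼(d + 1) | y 0 = 0} := Or.inr rfl
  have hmeas : MeasurableSet (stratumIn M {y : 𝔼(d + 1) | y 0 = 0})ᶜ :=
    hZ.isClosed_stratumIn.measurableSet.compl
  refine iSup_measure_eq_zero hmeas fun x => ?_
  have hempty : boundaryIncl d ⁻¹' (𝓒 x).target ∩
      ((𝓒 x).symm ∘ boundaryIncl d) ⁻¹' (stratumIn M {y : 𝔼(d + 1) | y 0 = 0})ᶜ = ∅ := by
    refine eq_empty_of_forall_notMem fun z hz => hz.2 ?_
    rw [Function.comp_apply, hZ.mem_stratumIn_iff ((𝓒 x).map_target hz.1), (𝓒 x).right_inv hz.1]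
    exact boundaryIncl_zero z
  rw [chartBoundaryVolume, map_withDensity_restrict_apply
    (continuousOn_extChartAt_symm_comp_boundaryIncl x) (measurableSet_boundaryIncl_preimage x)
    hmeas, hempty, Measure.restrict_empty, lintegral_zero_measure]

theorem LocalFormula.IsStratumInvariant.integrable_valueAt [CompactSpace M]
    (hP : P.IsStratumInvariant Z n) (g : AnalyticMetric d M)
    (hφ : ∀ μ, ContMDiff (𝓡∂ (d + 1)) 𝓘(ℝ, ℝ) ω (φ μ)) (hμ : μ (stratumIn M Z)ᶜ = 0) :
    Integrable (P.valueAt g φ) μ := by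
  have hclosed := hP.isStratum.isClosed_stratumIn (M := M)
  rw [← Measure.restrict_eq_self_of_ae_mem (mem_ae_iff.2 hμ)]
  exact (hP.continuousOn_valueAt g hφ).integrableOn_compact' hclosed.isCompact
    hclosed.measurableSet

end Volume

theorem theorem2p1_general (d k : ℕ) :
    ∃ (κE : ∀ n : ℕ, InteriorInvariant (d + 1) k n → ℝ)
      (κF : ∀ p : ℕ, BoundaryInvariant (d + 1) k p → ℝ),
      (∀ n E, 0 < κE n E) ∧ (∀ p F, 0 < κF p F) ∧
      ∀ (M : Type*) [TopologicalSpace M] [CompactSpace M] [Nonempty M]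
        [ChartedSpace (EuclideanHalfSpace (d + 1)) M] [IsManifold (𝓡∂ (d + 1)) ω M]
        [MeasurableSpace M] [BorelSpace M],
        ∃ C : AnalyticMetric d M → (Fin k → M → ℝ) → ℝ,
          ∀ (g : AnalyticMetric d M) (φ : Fin k → M → ℝ),
            (∀ μ, ContMDiff (𝓡∂ (d + 1)) 𝓘(ℝ, ℝ) ω (φ μ)) →
            0 < C g φ ∧
            riemannianVolume g univ < ⊤ ∧
            riemannianBoundaryVolume g univ < ⊤ ∧
            (∀ (n : ℕ) (E : InteriorInvariant (d + 1) k n),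
              Integrable (E.formula.valueAt g φ) (riemannianVolume g) ∧
              ((n ≠ 0 ∨ ∀ μ x, |φ μ x| ≤ 1) →
                |∫ x, E.formula.valueAt g φ x ∂(riemannianVolume g)| ≤
                  κE n E * C g φ ^ n * (riemannianVolume g).real univ)) ∧
            (∀ (p : ℕ) (F : BoundaryInvariant (d + 1) k p),
              Integrable (F.formula.valueAt g φ) (riemannianBoundaryVolume g) ∧
              ((p ≠ 0 ∨ ∀ μ x, |φ μ x| ≤ 1) →
                |∫ y, F.formula.valueAt g φ y ∂(riemannianBoundaryVolume g)| ≤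
                  κF p F * C g φ ^ p * (riemannianBoundaryVolume g).real univ)) ∧
            ∀ (c : ℝ) (hc : 0 < c), C (g.scale c hc) φ = c⁻¹ * C g φ := by
  refine ⟨fun n E => E.formula.kappa, fun p F => F.formula.kappa, fun n E => E.formula.kappa_pos,
    fun p F => F.formula.kappa_pos, ?_⟩
  intro M _ _ _ _ _ _ _
  obtain ⟨C, hC⟩ := exists_homogeneous_boundsInvariantsAt d k M
  refine ⟨C, fun g φ hφ => ?_⟩
  obtain ⟨hpos, hbound, hscale⟩ := hC g φ hφ
  have := isLocallyFiniteMeasure_riemannianVolume g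
  have := isLocallyFiniteMeasure_riemannianBoundaryVolume g
  have hE := riemannianVolume_compl_stratumIn_univ g
  have hF := riemannianBoundaryVolume_compl_boundary g
  exact ⟨hpos, measure_lt_top _ _, measure_lt_top _ _,
    fun n E => ⟨E.isStratumInvariant.integrable_valueAt g hφ hE,
      E.isStratumInvariant.abs_integral_valueAt_le hbound hE⟩,
    fun p F => ⟨F.isStratumInvariant.integrable_valueAt g hφ hF,
      F.isStratumInvariant.abs_integral_valueAt_le hbound hF⟩, hscale⟩

theorem theorem2p1 (d k : ℕ) :
    ∃ (κE : ∀ n : ℕ, InteriorInvariant (d + 1) k n → ℝ)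
      (κF : ∀ p : ℕ, BoundaryInvariant (d + 1) k p → ℝ),
      (∀ n E, 0 < κE n E) ∧ (∀ p F, 0 < κF p F) ∧
      ∀ (M : Type*) [TopologicalSpace M] [T2Space M] [CompactSpace M] [Nonempty M]
        [ChartedSpace (EuclideanHalfSpace (d + 1)) M] [IsManifold (𝓡∂ (d + 1)) ω M]
        [MeasurableSpace M] [BorelSpace M],
        ∃ C : AnalyticMetric d M → (Fin k → M → ℝ) → ℝ,
          ∀ (g : AnalyticMetric d M) (φ : Fin k → M → ℝ),
            (∀ μ, ContMDiff (𝓡∂ (d + 1)) 𝓘(ℝ, ℝ) ω (φ μ)) →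
            0 < C g φ ∧
            riemannianVolume g univ < ⊤ ∧
            riemannianBoundaryVolume g univ < ⊤ ∧
            (∀ (n : ℕ) (E : InteriorInvariant (d + 1) k n),
              Integrable (E.formula.valueAt g φ) (riemannianVolume g) ∧
              ((n ≠ 0 ∨ ∀ μ x, |φ μ x| ≤ 1) →
                |∫ x, E.formula.valueAt g φ x ∂(riemannianVolume g)| ≤
                  κE n E * C g φ ^ n * (riemannianVolume g).real univ)) ∧
            (∀ (p : ℕ) (F : BoundaryInvariant (d + 1) k p),
              Integrable (F.formula.valueAt g φ) (riemannianBoundaryVolume g) ∧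
              ((p ≠ 0 ∨ ∀ μ x, |φ μ x| ≤ 1) →
                |∫ y, F.formula.valueAt g φ y ∂(riemannianBoundaryVolume g)| ≤
                  κF p F * C g φ ^ p * (riemannianBoundaryVolume g).real univ)) ∧
            ∀ (c : ℝ) (hc : 0 < c), C (g.scale c hc) φ = c⁻¹ * C g φ := by
  obtain ⟨κE, κF, hE, hF, h⟩ := theorem2p1_general d k
  exact ⟨κE, κF, hE, hF, fun M => h M⟩
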